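/- Let $A_0$ be a nonnegative self-adjoint operator in a complex Hilbert space $\mathfrak H$ with inner product $(\cdot,\cdot)$, linear in the first argument. Let $\mathfrak H_1(A_0)=\mathcal D(A_0^{1/2})$, and let $\mathfrak H_{-k}(A_0)$, $k=1,2$, be the completion of $\mathfrak H$ in the norm $\|(A_0+I)^{-k/2}u\|$, so that $\mathfrak H\subset\mathfrak H_{-1}(A_0)\subset\mathfrak H_{-2}(A_0)$. Let $(\mathbb A_0+I)^{-1}:\mathfrak H_{-2}(A_0)\to\mathfrak H$ be the continuous extension of $(A_0+I)^{-1}$, and put $\langle\psi,u\rangle=((A_0+I)u,(\mathbb A_0+I)^{-1}\psi)$ for $\psi\in\mathfrak H_{-2}(A_0)$, $u\in\mathcal D(A_0)$. Let $\mathfrak T\subset\mathbb R$ and let $\{U_t\}_{t\in\mathfrak T}$ be a family of unitary operators in $\mathfrak H$ that contains with every $U_t$ its adjoint $U_t^*$. For a function $p:\mathfrak T\to\mathbb R$, an operator $B\neq0$ in $\mathfrak H$ is called $p(t)$-homogeneous if $U_tB=p(t)BU_t$ (with equality of domains) for all $t\in\mathfrak T$. Suppose that $A_0$ is $p(t)$-homogeneous,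 and let $\mathbb U_t$ be the continuous extension of $U_t$ to $\mathfrak H_{-2}(A_0)$. Let $\psi_1,\dots,\psi_n\in\mathfrak H_{-2}(A_0)$ be linearly independent, with linear span $\mathcal X$, and suppose that there are real functions $\xi_j$ on $\mathfrak T$ with $\mathbb U_t\psi_j=\xi_j(t)\psi_j$ for all $t\in\mathfrak T$, $1\le j\le n$. Put $h_j=(\mathbb A_0+I)^{-1}\psi_j$ and let $A_{\rm sym}$ be the restriction of $A_0$ to $\{u\in\mathcal D(A_0):\langle\psi_j,u\rangle=0,\ 1\le j\le n\}$. A Hermitian matrix $\mathbf R=(r_{jp})_{j,p=1}^n$ defines functionals $$\langle\psi_j^{\rm ex},f\rangle=\langle\psi_j,u\rangle+\sum_{p=1}^n r_{jp}\alpha_p,\qquad f=u+\sum_{p=1}^n\alpha_ph_p\in\mathcal D(A_{\rm sym}^*),\quad u\in\mathcal D(A_0),\ \alpha_p\in\mathbb C .$$ It is called admissible if, whenever $\psi=\sum_jc_j\psi_j\in\mathfrak H_{-1}(A_0)$ and $h=(\mathbb A_0+I)^{-1}\psi$, one has $\sum_j\overline{c_j}\,\langle\psi_j^{\rm ex},f\rangle=((A_0+I)^{1/2}f,(A_0+I)^{1/2}h)$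 for all $f\in\mathcal D(A_{\rm sym}^*)\cap\mathfrak H_1(A_0)$. An operator is called admissible if it is the restriction of $A_{\rm sym}^*$ to $\{f\in\mathcal D(A_{\rm sym}^*):\langle\psi_j^{\rm ex},f\rangle=0,\ 1\le j\le n\}$ for some admissible matrix $\mathbf R$. The Krein–von Neumann extension of $A_{\rm sym}$ is the smallest nonnegative self-adjoint extension, that is, the nonnegative self-adjoint extension $A_N$ with $(B+I)^{-1}\le(A_N+I)^{-1}$ for every nonnegative self-adjoint extension $B$ of $A_{\rm sym}$. **Theorem.** Suppose that the $\psi_j$ are $\mathfrak H_{-1}(A_0)$-independent, that is, $\mathcal X\cap\mathfrak H_{-1}(A_0)=\{0\}$, and that there is exactly one complex matrix $\mathbf R=(r_{ij})_{i,j=1}^n$, independent of $t$, with $$\Bigl(\xi_i(t)-\frac{p(t)}{\xi_j(t)}\Bigr)r_{ij}=(1-p(t))\,(h_j,U_th_i),\qquad 1\le i,j\le n,\quad t\in\mathfrak T .$$ Then there exists exactly one $p(t)$-homogeneous admissible operator $\widetilde A$, and it is the Krein–von Neumann extension $A_N$ of $A_{\rm sym}$. -/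

import Mathlib

open scoped InnerProductSpace ComplexConjugate

noncomputable section

namespace SingularPerturbation

variable {H : Type*} [NormedAddCommGroup H] [InnerProductSpace ℂ H] [CompleteSpace H]

/-- The operator `A` is nonnegative: `(A x, x) ≥ 0` on its domain. -/
def IsNonneg (A : H →ₗ.[ℂ] H) : Prop :=
  ∀ x : A.domain, 0 ≤ (⟪A x, (x : H)⟫_ℂ).re

/-- `A + I` on the domain of `A`. -/
def shift (A : H →ₗ.[ℂ] H) : A.domain →ₗ[ℂ] H := A.toFun + A.domain.subtype

/-- `R` is the bounded everywhere defined inverse of `A + I : D(A) → H`. -/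
def IsShiftInverse (A : H →ₗ.[ℂ] H) (R : H →L[ℂ] H) : Prop :=
  ∀ x y : H, R x = y ↔ ∃ u : A.domain, (u : H) = y ∧ shift A u = x

lemma norm_le_norm_shift {A : H →ₗ.[ℂ] H} (hpos : IsNonneg A) (u : A.domain) :
    ‖(u : H)‖ ≤ ‖shift A u‖ := by
  by_cases hu : ‖(u : H)‖ = 0
  · rw [hu]; exact norm_nonneg _
  have hu' : 0 < ‖(u : H)‖ := lt_of_le_of_ne (norm_nonneg _) (Ne.symm hu)
  have h1 : (⟪shift A u, (u : H)⟫_ℂ).re = (⟪A u, (u : H)⟫_ℂ).re + ‖(u : H)‖ ^ 2 := by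
    have h3 : ⟪(u : H), (u : H)⟫_ℂ = ((‖(u : H)‖ : ℂ)) ^ 2 := inner_self_eq_norm_sq_to_K _
    have : shift A u = A u + u := rfl
    rw [this, inner_add_left, Complex.add_re, h3]
    norm_cast
  have h2 : (⟪shift A u, (u : H)⟫_ℂ).re ≤ ‖shift A u‖ * ‖(u : H)‖ :=
    (Complex.re_le_norm _).trans (norm_inner_le_norm _ _)
  have h0 := hpos u
  nlinarith

/-- For a nonnegative self-adjoint operator `A` the operator `(A + I)⁻¹` exists. -/
theorem exists_isShiftInverse {A : H →ₗ.[ℂ] H} (hA : IsSelfAdjoint A) (hpos : IsNonneg A) :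
    ∃ R : H →L[ℂ] H, IsShiftInverse A R := by
  have hdense : Dense (A.domain : Set H) := hA.dense_domain
  have hclosed : A.IsClosed := hA.isClosed
  have hadj : A.adjoint = A := hA
  have hinj : Function.Injective (shift A) := by
    rw [← LinearMap.ker_eq_bot, LinearMap.ker_eq_bot']
    intro u hu
    have := norm_le_norm_shift hpos u
    rw [hu, norm_zero] at this
    exact Subtype.ext (norm_le_zero_iff.mp this)
  have hrc : IsClosed ((LinearMap.range (shift A) : Submodule ℂ H) : Set H) := by
    rw [← isSeqClosed_iff_isClosed]
    intro x a hx hxa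
    choose u hu using hx
    have hc : CauchySeq (fun k => (u k : H)) := by
      have hxc : CauchySeq x := hxa.cauchySeq
      rw [Metric.cauchySeq_iff] at hxc ⊢
      intro ε hε
      obtain ⟨N, hN⟩ := hxc ε hε
      refine ⟨N, fun m hm k hk => ?_⟩
      have h1 := norm_le_norm_shift hpos (u m - u k)
      rw [map_sub, hu, hu] at h1
      have h2 := hN m hm k hk
      rw [dist_eq_norm] at h2 ⊢
      exact lt_of_le_of_lt h1 h2
    obtain ⟨b, hb⟩ := cauchySeq_tendsto_of_complete hc
    have hg : (b, a - b) ∈ (A.graph : Set (H × H)) := by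
      refine hclosed.mem_of_tendsto (b := Filter.atTop)
        (f := fun k => ((u k : H), x k - (u k : H))) (hb.prodMk_nhds (hxa.sub hb))
        (Filter.Eventually.of_forall fun k => ?_)
      have : x k - (u k : H) = A (u k) := by
        rw [← hu k]; change A (u k) + (u k : H) - (u k : H) = _; abel
      rw [this]
      exact A.mem_graph (u k)
    obtain ⟨v, hv1, hv2⟩ := (LinearPMap.mem_graph_iff A).mp hg
    refine ⟨v, ?_⟩
    change A v + (v : H) = a
    simp only at hv1 hv2
    rw [hv1, hv2]; abel
  have hsurj : Function.Surjective (shift A) := by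
    rw [← LinearMap.range_eq_top]
    have : Submodule.HasOrthogonalProjection (LinearMap.range (shift A)) := by
      have : CompleteSpace (LinearMap.range (shift A)) := hrc.completeSpace_coe
      infer_instance
    rw [← Submodule.orthogonal_eq_bot_iff, Submodule.eq_bot_iff]
    intro z hz
    have hz' : ∀ x : A.domain, ⟪-z, (x : H)⟫_ℂ = ⟪z, A x⟫_ℂ := by
      intro x
      have h := (Submodule.mem_orthogonal' _ _).mp hz (shift A x) ⟨x, rfl⟩
      have h' : ⟪z, A x⟫_ℂ + ⟪z, (x : H)⟫_ℂ = 0 := by rw [← inner_add_right]; exact h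
      rw [inner_neg_left]
      linear_combination -h'
    have hzd : z ∈ A.adjoint.domain := LinearPMap.mem_adjoint_domain_of_exists z ⟨-z, hz'⟩
    have hval : A.adjoint ⟨z, hzd⟩ = -z :=
      LinearPMap.adjoint_apply_eq hdense ⟨z, hzd⟩ hz'
    have key : ∀ B : H →ₗ.[ℂ] H, IsNonneg B → ∀ h : z ∈ B.domain, B ⟨z, h⟩ = -z → z = 0 := by
      intro B hB h hBz
      have := norm_le_norm_shift hB ⟨z, h⟩
      have h0 : shift B ⟨z, h⟩ = 0 := by
        change B ⟨z, h⟩ + z = 0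
        rw [hBz]; abel
      rw [h0, norm_zero] at this
      exact norm_le_zero_iff.mp this
    exact key A.adjoint (by rw [hadj]; exact hpos) hzd hval
  let e := LinearEquiv.ofBijective (shift A) ⟨hinj, hsurj⟩
  have he : ∀ x, shift A (e.symm x) = x := fun x => e.apply_symm_apply x
  refine ⟨LinearMap.mkContinuous (A.domain.subtype ∘ₗ e.symm.toLinearMap) 1 fun x => ?_, ?_⟩
  · have := norm_le_norm_shift hpos (e.symm x)
    rw [he] at this
    simpa using this
  · intro x y
    constructor
    · intro h
      exact ⟨e.symm x, h, he x⟩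
    · rintro ⟨u, rfl, hu⟩
      have : e.symm x = u := by
        rw [LinearEquiv.symm_apply_eq]; exact hu.symm
      change ((e.symm x : A.domain) : H) = u
      rw [this]

open Classical in
/-- The bounded operator `(A + I)⁻¹` (zero if there is no such operator). -/
def resolvent (A : H →ₗ.[ℂ] H) : H →L[ℂ] H :=
  if h : ∃ R : H →L[ℂ] H, IsShiftInverse A R then h.choose else 0

theorem resolvent_spec {A : H →ₗ.[ℂ] H} (hA : IsSelfAdjoint A) (hpos : IsNonneg A) :
    IsShiftInverse A (resolvent A) := by
  have h := exists_isShiftInverse hA hpos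
  rw [resolvent, dif_pos h]
  exact h.choose_spec

/-- The bounded operator `(A + I)^{-1/2}`. -/
def sqrtResolvent (A : H →ₗ.[ℂ] H) : H →L[ℂ] H := CFC.sqrt (resolvent A)

/-- The unbounded operator `(A + I)^{1/2}`, the inverse of `(A + I)^{-1/2}`.  Its domain is
`H₁(A) = D(A^{1/2}) = D((A + I)^{1/2})`. -/
def sqrtShift (A : H →ₗ.[ℂ] H) : H →ₗ.[ℂ] H :=
  ((sqrtResolvent A : H →L[ℂ] H).toLinearMap.toPMap ⊤).inverse

/-- The space `H` with the (semi)norm `u ↦ ‖S u‖`. -/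
def Renormed (_S : H →L[ℂ] H) : Type _ := H

instance (S : H →L[ℂ] H) : AddCommGroup (Renormed S) := inferInstanceAs (AddCommGroup H)

instance (S : H →L[ℂ] H) : Module ℂ (Renormed S) := inferInstanceAs (Module ℂ H)

/-- The vector `u` of `H`, seen in the renormed space. -/
def Renormed.of (S : H →L[ℂ] H) : H ≃ₗ[ℂ] Renormed S := LinearEquiv.refl ℂ H

/-- The linear map `S`, from the renormed space to `H`. -/
def Renormed.toH (S : H →L[ℂ] H) : Renormed S →ₗ[ℂ] H :=
  S.toLinearMap ∘ₗ (Renormed.of S).symm.toLinearMap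

instance (S : H →L[ℂ] H) : SeminormedAddCommGroup (Renormed S) :=
  SeminormedAddCommGroup.induced (Renormed S) H (Renormed.toH S)

instance (S : H →L[ℂ] H) : NormedSpace ℂ (Renormed S) :=
  NormedSpace.induced ℂ (Renormed S) H (Renormed.toH S)

theorem Renormed.norm_of (S : H →L[ℂ] H) (u : H) : ‖Renormed.of S u‖ = ‖S u‖ := rfl

/-- `H₋₂(A)`: the completion of `H` in the norm `‖(A + I)⁻¹ u‖`. -/
abbrev HNegTwo (A : H →ₗ.[ℂ] H) : Type _ := UniformSpace.Completion (Renormed (resolvent A))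

/-- `H₋₁(A)`: the completion of `H` in the norm `‖(A + I)^{-1/2} u‖`. -/
abbrev HNegOne (A : H →ₗ.[ℂ] H) : Type _ := UniformSpace.Completion (Renormed (sqrtResolvent A))

/-- The embedding of `H₋₁(A)` into `H₋₂(A)`: the continuous extension of the identity of `H`. -/
def negOneToNegTwo (A : H →ₗ.[ℂ] H) : HNegOne A → HNegTwo A :=
  UniformSpace.Completion.map fun u =>
    Renormed.of (resolvent A) ((Renormed.of (sqrtResolvent A)).symm u)

/-- `ψ ∈ H₋₂(A)` belongs to `H₋₁(A)`. -/
def MemHNegOne (A : H →ₗ.[ℂ] H) (ψ : HNegTwo A) : Prop := ψ ∈ Set.range (negOneToNegTwo A)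

/-- The continuous extension to `H₋₂(A) → H` of the resolvent `(A + I)⁻¹` of `A`. -/
def extResolvent (A : H →ₗ.[ℂ] H) : HNegTwo A → H :=
  UniformSpace.Completion.extension (Renormed.toH (resolvent A))

/-- The continuous extension of a unitary operator of `H` to `H₋₂(A)`. -/
def extUnitary (A : H →ₗ.[ℂ] H) (V : H ≃ₗᵢ[ℂ] H) : HNegTwo A → HNegTwo A :=
  UniformSpace.Completion.map fun u =>
    Renormed.of (resolvent A) (V ((Renormed.of (resolvent A)).symm u))

/-- The functional `<ψ, u> = ((A + I) u, (A + I)⁻¹ ψ)`, `u ∈ D(A)`.  In Mathlib the inner product is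
linear in the second argument. -/
def pairing (A : H →ₗ.[ℂ] H) (ψ : HNegTwo A) : A.domain →ₗ[ℂ] ℂ :=
  (innerₛₗ ℂ (extResolvent A ψ)) ∘ₗ shift A

variable {n : ℕ}

/-- `A_sym`: the restriction of `A` to the `u ∈ D(A)` with `<ψ_j, u> = 0` for all `j`. -/
def symOp (A : H →ₗ.[ℂ] H) (ψ : Fin n → HNegTwo A) : H →ₗ.[ℂ] H :=
  A.domRestrict ((⨅ j, LinearMap.ker (pairing A (ψ j))).map A.domain.subtype)

/-- The map `(u, α) ↦ u + ∑ α_p h_p`, `h_p = (A + I)⁻¹ ψ_p`, from `D(A) × ℂⁿ` onto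
`D(A_sym*)`. -/
def compose (A : H →ₗ.[ℂ] H) (ψ : Fin n → HNegTwo A) :
    (A.domain × (Fin n → ℂ)) →ₗ[ℂ] H :=
  A.domain.subtype.coprod (Fintype.linearCombination ℂ fun p => extResolvent A (ψ p))

/-- The extended functionals `<ψ_j^ex, f> = <ψ_j, u> + ∑ₚ r_{jp} α_p` for `f = u + ∑ α_p h_p`,
as functions of the pair `(u, α)`. -/
def exPairing (A : H →ₗ.[ℂ] H) (ψ : Fin n → HNegTwo A) (R : Matrix (Fin n) (Fin n) ℂ) :
    (A.domain × (Fin n → ℂ)) →ₗ[ℂ] (Fin n → ℂ) :=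
  (LinearMap.pi fun j => pairing A (ψ j)).coprod R.mulVecLin

/-- The restriction of `A_sym*` to the `f` with `<ψ_j^ex, f> = 0` for all `j`. -/
def extensionOf (A : H →ₗ.[ℂ] H) (ψ : Fin n → HNegTwo A) (R : Matrix (Fin n) (Fin n) ℂ) :
    H →ₗ.[ℂ] H :=
  (symOp A ψ).adjoint.domRestrict ((LinearMap.ker (exPairing A ψ R)).map (compose A ψ))

/-- The Hermitian matrix `R` is admissible: whenever `ψ = ∑ c_j ψ_j` belongs to `H₋₁(A)`, the
extended functional `<ψ^ex, ·>` agrees on `D(A_sym*) ∩ H₁(A)` with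
`((A + I)^{1/2} f, (A + I)^{1/2} h)`, where `h = (A + I)⁻¹ ψ`.  Since `<ψ, ·>` depends
conjugate-linearly on `ψ`, the coefficients of `<ψ_j^ex, ·>` in `<ψ^ex, ·>` are `conj c_j`. -/
def IsAdmissibleMatrix (A : H →ₗ.[ℂ] H) (ψ : Fin n → HNegTwo A)
    (R : Matrix (Fin n) (Fin n) ℂ) : Prop :=
  R.IsHermitian ∧
    ∀ c : Fin n → ℂ, MemHNegOne A (∑ j, c j • ψ j) →
      ∀ (w : A.domain × (Fin n → ℂ)) (f h : (sqrtShift A).domain),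
        compose A ψ w ∈ (symOp A ψ).adjoint.domain →
        (f : H) = compose A ψ w →
        (h : H) = extResolvent A (∑ j, c j • ψ j) →
        ∑ j, conj (c j) * exPairing A ψ R w j = ⟪sqrtShift A h, sqrtShift A f⟫_ℂ

/-- Admissible operators: the operators given by admissible matrices. -/
def IsAdmissibleOperator (A : H →ₗ.[ℂ] H) (ψ : Fin n → HNegTwo A) (B : H →ₗ.[ℂ] H) : Prop :=
  ∃ R : Matrix (Fin n) (Fin n) ℂ, IsAdmissibleMatrix A ψ R ∧ B = extensionOf A ψ R

/-- `B ≠ 0` is `p(t)`-homogeneous: `U_t B = p(t) B U_t` for all `t`, as an equality of unbounded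
operators (the domains `D(B)` and `{x | U_t x ∈ D(B)}` are equal too). -/
structure IsHomogeneous {T : Set ℝ} (U : T → H ≃ₗᵢ[ℂ] H) (p : T → ℝ) (B : H →ₗ.[ℂ] H) : Prop where
  ne_zero : ∃ x : B.domain, B x ≠ 0
  mem_iff : ∀ (t : T) (x : H), x ∈ B.domain ↔ U t x ∈ B.domain
  map_eq : ∀ (t : T) (x : B.domain),
    U t (B x) = (p t : ℂ) • B ⟨U t x, (mem_iff t x).mp x.2⟩

/-- `N` is the Krein–von Neumann extension of `S`: the smallest nonnegative self-adjoint extension,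
i.e. the one with the largest resolvent `(N + I)⁻¹`. -/
structure IsKreinVonNeumannExtension (S N : H →ₗ.[ℂ] H) : Prop where
  le : S ≤ N
  isSelfAdjoint : IsSelfAdjoint N
  isNonneg : IsNonneg N
  resolvent_le : ∀ B : H →ₗ.[ℂ] H, S ≤ B → IsSelfAdjoint B → IsNonneg B →
    resolvent B ≤ resolvent N

end SingularPerturbation

end

open SingularPerturbation

open scoped InnerProductSpace ComplexConjugate
open Filter Topology

/-! ### Bounded calculus for a symmetric operator with `K² ≤ K` -/

namespace SingularPerturbation

variable {H : Type*} [NormedAddCommGroup H] [InnerProductSpace ℂ H]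

/-! Write `K = (A₀ + I)⁻¹` and `M(m)_ij = m (h_i, (1 - m K)⁻¹ h_j)` for `m < 1`. This is the Weyl
function of `A_sym` at the spectral point `λ = m - 1 < 0`, normalised to vanish at `λ = -1`. The
proof shows that the solution `R` of the scaling equations is `-M(0-)`, the limit at `λ → 0-`, and
that this boundary matrix gives the Krein–von Neumann extension.

A unitary `V` with `V A₀ = q A₀ V` and `V ψ_j = ξ_j ψ_j` carries defect vectors at `λ` to defect
vectors at `λ / q` (`IsScaling.map_neumann`). Together with the scaling equations this makes `M + R`
homogeneous: `(M + R)_ij` at `λ / q` is `q / (ξ_i ξ_j)` times its value at `λ`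
(`IsScaling.weylForm_add_eq`). Uniqueness of `R` supplies, for each pair `(i, j)`, some `t` for
which this factor is not `1`; it also makes `R` Hermitian.

Each `M_ii` is nondecreasing in `m`, and it is unbounded below because `ψ_i ∉ H₋₁`
(`memHNegOne_of_weylForm_bounded`). Homogeneity then forces `(M + R)_ii → 0` as `m → 1`
(`tendsto_zero_of_homogeneous`). Increments of `M_ij` are controlled by those of `M_ii` and `M_jj`
through Cauchy–Schwarz, so the other entries of `M + R` also tend to `0` (`tendsto_weylForm_add`),
and the form of `M(m) + R` is nonpositive for every `m < 1`.

This sign gives nonnegativity of the extension `N` defined by `R`. The limit lets `N f` be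
approximated by `A_sym x` with `limsup (A_sym x, x) ≤ (N f, f)`. Cauchy–Schwarz for an arbitrary
nonnegative self-adjoint extension `B` then yields `|(N f, g)|² ≤ (N f, f)(B g, g)`
(`sq_norm_inner_extensionOf_le`), hence the comparison of resolvents.

Finally, an extension given by a matrix is homogeneous exactly when the matrix solves the scaling
equations (`IsScaling.inner_add_mulVec`), which gives existence and uniqueness. Admissibility
imposes only the Hermitian condition, since `X ∩ H₋₁ = {0}`. -/

lemma re_inner_self (x : H) : (⟪x, x⟫_ℂ).re = ‖x‖ ^ 2 := inner_self_eq_norm_sq (𝕜 := ℂ) x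

lemma re_inner_comm (x y : H) : (⟪x, y⟫_ℂ).re = (⟪y, x⟫_ℂ).re := inner_re_symm (𝕜 := ℂ) x y

/-- The Cauchy–Schwarz inequality for a nonnegative symmetric operator. -/
lemma sq_norm_inner_le_of_symmetric {V : Type*} [AddCommGroup V] [Module ℂ V] (ι T : V →ₗ[ℂ] H)
    (hsymm : ∀ x y, ⟪T x, ι y⟫_ℂ = ⟪ι x, T y⟫_ℂ) (hpos : ∀ x, 0 ≤ (⟪T x, ι x⟫_ℂ).re) (x y : V) :
    ‖⟪T x, ι y⟫_ℂ‖ ^ 2 ≤ (⟪T x, ι x⟫_ℂ).re * (⟪T y, ι y⟫_ℂ).re := by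
  let c : PreInnerProductSpace.Core ℂ V :=
    { inner := fun x y => ⟪T x, ι y⟫_ℂ
      conj_inner_symm := fun x y => by rw [inner_conj_symm, hsymm]
      re_inner_nonneg := hpos
      add_left := fun x y z => by simp
      smul_left := fun x y r => by simp [mul_comm] }
  have h := @InnerProductSpace.Core.inner_mul_inner_self_le ℂ V _ _ _ c x y
  have h1 : ‖⟪T y, ι x⟫_ℂ‖ = ‖⟪T x, ι y⟫_ℂ‖ := by rw [hsymm, norm_inner_symm]
  have h2 : ‖⟪T x, ι y⟫_ℂ‖ * ‖⟪T y, ι x⟫_ℂ‖ ≤ (⟪T x, ι x⟫_ℂ).re * (⟪T y, ι y⟫_ℂ).re := h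
  rw [h1] at h2
  rw [sq]; exact h2

/-- `K` is symmetric with `K² ≤ K`. -/
structure IsFirmlyNonexpansive (K : H →L[ℂ] H) : Prop where
  symm : ∀ x y, ⟪K x, y⟫_ℂ = ⟪x, K y⟫_ℂ
  sq_le : ∀ x, ‖K x‖ ^ 2 ≤ (⟪K x, x⟫_ℂ).re

namespace IsFirmlyNonexpansive

variable {K : H →L[ℂ] H}

lemma nonneg (hK : IsFirmlyNonexpansive K) (x : H) : 0 ≤ (⟪K x, x⟫_ℂ).re :=
  (sq_nonneg _).trans (hK.sq_le x)

lemma norm_le (hK : IsFirmlyNonexpansive K) (x : H) : ‖K x‖ ≤ ‖x‖ := by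
  have h1 := hK.sq_le x
  have h2 : (⟪K x, x⟫_ℂ).re ≤ ‖K x‖ * ‖x‖ :=
    (Complex.re_le_norm _).trans (norm_inner_le_norm _ _)
  by_contra! h
  nlinarith [norm_nonneg x]

lemma inner_le (hK : IsFirmlyNonexpansive K) (x : H) : (⟪K x, x⟫_ℂ).re ≤ ‖x‖ ^ 2 := by
  have h2 : (⟪K x, x⟫_ℂ).re ≤ ‖K x‖ * ‖x‖ :=
    (Complex.re_le_norm _).trans (norm_inner_le_norm _ _)
  nlinarith [hK.norm_le x, norm_nonneg x]

lemma re_inner_sub_smul (m : ℝ) (x : H) :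
    (⟪x - (m : ℂ) • K x, x⟫_ℂ).re = ‖x‖ ^ 2 - m * (⟪K x, x⟫_ℂ).re := by
  rw [inner_sub_left, inner_smul_left, Complex.sub_re, Complex.conj_ofReal, Complex.re_ofReal_mul,
    re_inner_self]

lemma one_sub_mul_le (hK : IsFirmlyNonexpansive K) {m : ℝ} (hm : 0 ≤ m) (x : H) :
    (1 - m) * ‖x‖ ^ 2 ≤ (⟪x - (m : ℂ) • K x, x⟫_ℂ).re := by
  rw [re_inner_sub_smul]
  nlinarith [hK.inner_le x]

lemma sq_norm_le (hK : IsFirmlyNonexpansive K) {m : ℝ} (hm : m ≤ 0) (x : H) :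
    ‖x‖ ^ 2 ≤ (⟪x - (m : ℂ) • K x, x⟫_ℂ).re := by
  rw [re_inner_sub_smul]
  nlinarith [hK.nonneg x]

end IsFirmlyNonexpansive

/-- The bounded operator `(1 - m K)⁻¹`. -/
noncomputable def neumann (K : H →L[ℂ] H) (m : ℝ) : H →L[ℂ] H := Ring.inverse (1 - (m : ℂ) • K)

/-- The form `m (x, (1 - m K)⁻¹ y)`. -/
noncomputable def weylForm (K : H →L[ℂ] H) (m : ℝ) (x y : H) : ℂ := (m : ℂ) * ⟪x, neumann K m y⟫_ℂ

namespace IsFirmlyNonexpansive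

variable {K : H →L[ℂ] H} [CompleteSpace H]

/-- Coercivity: since `0 ≤ K ≤ 1`, the form of `1 - m K` is bounded below by `1 - m` when `m ≥ 0`
and by `1` when `m ≤ 0`. -/
lemma isUnit (hK : IsFirmlyNonexpansive K) {m : ℝ} (hm : m < 1) :
    IsUnit (1 - (m : ℂ) • K : H →L[ℂ] H) := by
  have key : ∀ c : ℝ, 0 < c → (∀ x : H, c * ‖x‖ ^ 2 ≤ (⟪x - (m : ℂ) • K x, x⟫_ℂ).re) →
      IsUnit (1 - (m : ℂ) • K : H →L[ℂ] H) := fun c hc h =>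
    ContinuousLinearMap.isUnit_of_forall_le_norm_inner_map _ (c := ⟨c, hc.le⟩) hc fun x => by
      rw [mul_comm]
      exact (h x).trans (Complex.re_le_norm _)
  rcases le_total 0 m with h0 | h0
  · exact key (1 - m) (by linarith) (hK.one_sub_mul_le h0)
  · exact key 1 one_pos fun x => by rw [one_mul]; exact hK.sq_norm_le h0 x

lemma neumann_sub (hK : IsFirmlyNonexpansive K) {m : ℝ} (hm : m < 1) (x : H) :
    neumann K m x - (m : ℂ) • K (neumann K m x) = x := by
  simpa [neumann] using congrArg (fun f : H →L[ℂ] H => f x) (Ring.mul_inverse_cancel _ (hK.isUnit hm))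

lemma neumann_map_sub (hK : IsFirmlyNonexpansive K) {m : ℝ} (hm : m < 1) (x : H) :
    neumann K m (x - (m : ℂ) • K x) = x := by
  simpa [neumann] using congrArg (fun f : H →L[ℂ] H => f x) (Ring.inverse_mul_cancel _ (hK.isUnit hm))

lemma neumann_eq (hK : IsFirmlyNonexpansive K) {m : ℝ} (hm : m < 1) {x y : H}
    (h : x - (m : ℂ) • K x = y) : neumann K m y = x := by
  rw [← h, hK.neumann_map_sub hm]

lemma apply_neumann (hK : IsFirmlyNonexpansive K) {m : ℝ} (hm : m < 1) (x : H) :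
    K (neumann K m x) = neumann K m (K x) := by
  refine (hK.neumann_eq hm ?_).symm
  rw [← map_smul, ← map_sub, hK.neumann_sub hm]

lemma neumann_comm (hK : IsFirmlyNonexpansive K) {m m' : ℝ} (hm : m < 1) (hm' : m' < 1) (x : H) :
    neumann K m' (neumann K m x) = neumann K m (neumann K m' x) := by
  refine hK.neumann_eq hm' ?_
  rw [hK.apply_neumann hm, ← map_smul, ← map_sub, hK.neumann_sub hm']

lemma neumann_symm (hK : IsFirmlyNonexpansive K) {m : ℝ} (hm : m < 1) (x y : H) :
    ⟪neumann K m x, y⟫_ℂ = ⟪x, neumann K m y⟫_ℂ := by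
  conv_lhs => rw [← hK.neumann_sub hm y]
  conv_rhs => rw [← hK.neumann_sub hm x]
  rw [inner_sub_right, inner_sub_left, inner_smul_right, inner_smul_left, hK.symm,
    Complex.conj_ofReal]

lemma neumann_resolvent (hK : IsFirmlyNonexpansive K) {m m' : ℝ} (hm : m < 1) (hm' : m' < 1)
    (x : H) : (m' : ℂ) • neumann K m' x - (m : ℂ) • neumann K m x =
      ((m' - m : ℝ) : ℂ) • neumann K m' (neumann K m x) := by
  conv_lhs => rw [← hK.neumann_map_sub hm' (neumann K m x)]
  conv_lhs => arg 1; arg 2; arg 2; rw [← hK.neumann_sub hm x]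
  simp only [← map_smul, ← map_sub]
  congr 1
  simp only [map_smul]
  push_cast
  module

lemma sq_norm_neumann_le (hK : IsFirmlyNonexpansive K) {m : ℝ} (hm : m ≤ 0) (x : H) :
    ‖neumann K m x‖ ^ 2 ≤ (⟪x, neumann K m x⟫_ℂ).re := by
  have := hK.sq_norm_le hm (neumann K m x)
  rwa [hK.neumann_sub (by linarith)] at this

lemma one_sub_mul_sq_norm_neumann_le (hK : IsFirmlyNonexpansive K) {m : ℝ} (h0 : 0 ≤ m)
    (hm : m < 1) (x : H) : (1 - m) * ‖neumann K m x‖ ^ 2 ≤ (⟪x, neumann K m x⟫_ℂ).re := by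
  have := hK.one_sub_mul_le h0 (neumann K m x)
  rwa [hK.neumann_sub hm] at this

/-- In terms of `z`, the two sides differ by `(m' - m) ((K z, z) - m' ‖K z‖²)`, which is nonnegative
by `K² ≤ K` and `m' < 1`. Through the resolvent identity, positivity of the product of the two
inverses is what makes the Weyl form monotone. -/
lemma sq_norm_le_inner_neumann_neumann (hK : IsFirmlyNonexpansive K) {m m' : ℝ} (h : m ≤ m')
    (hm' : m' < 1) (x : H) :
    ‖neumann K m x‖ ^ 2 ≤ (⟪neumann K m' (neumann K m x), x⟫_ℂ).re := by
  have hm := h.trans_lt hm'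
  set z := neumann K m' (neumann K m x) with hz
  have h1 : neumann K m x = z - (m' : ℂ) • K z := (hK.neumann_sub hm' _).symm
  have h2 : x = (z - (m' : ℂ) • K z) - (m : ℂ) • K (z - (m' : ℂ) • K z) := by
    rw [← h1, hK.neumann_sub hm]
  rw [h1, h2]
  have h3 := hK.sq_le z
  have e1 : ‖z - (m' : ℂ) • K z‖ ^ 2 =
      ‖z‖ ^ 2 - 2 * m' * (⟪K z, z⟫_ℂ).re + m' ^ 2 * ‖K z‖ ^ 2 := by
    rw [← re_inner_self, ← re_inner_self, ← re_inner_self]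
    simp only [inner_sub_left, inner_sub_right, inner_smul_left, inner_smul_right,
      Complex.conj_ofReal, Complex.sub_re, Complex.re_ofReal_mul, re_inner_comm z (K z)]
    ring
  have e2 : (⟪z, (z - (m' : ℂ) • K z) - (m : ℂ) • K (z - (m' : ℂ) • K z)⟫_ℂ).re =
      ‖z‖ ^ 2 - (m + m') * (⟪K z, z⟫_ℂ).re + m * m' * ‖K z‖ ^ 2 := by
    rw [← re_inner_self, ← re_inner_self]
    simp only [map_sub, map_smul, inner_sub_right, inner_smul_right, ← hK.symm, Complex.sub_re,
      Complex.re_ofReal_mul]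
    rw [hK.symm (K z) z]
    ring
  rw [e1, e2]
  nlinarith [mul_nonneg (sub_nonneg.2 h) (sub_nonneg.2 h3),
    mul_nonneg (mul_nonneg (sub_nonneg.2 h) (sub_nonneg.2 hm'.le)) (sq_nonneg ‖K z‖)]

lemma weylForm_sub (hK : IsFirmlyNonexpansive K) {m m' : ℝ} (hm : m < 1) (hm' : m' < 1)
    (x y : H) : weylForm K m' x y - weylForm K m x y =
      ((m' - m : ℝ) : ℂ) * ⟪x, neumann K m' (neumann K m y)⟫_ℂ := by
  rw [weylForm, weylForm, ← inner_smul_right, ← inner_smul_right, ← inner_sub_right,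
    hK.neumann_resolvent hm hm', inner_smul_right]

lemma weylForm_self_mono (hK : IsFirmlyNonexpansive K) {m m' : ℝ} (h : m ≤ m') (hm' : m' < 1)
    (x : H) : (weylForm K m x x).re ≤ (weylForm K m' x x).re := by
  rw [← sub_nonneg, ← Complex.sub_re, hK.weylForm_sub (h.trans_lt hm') hm', Complex.re_ofReal_mul,
    re_inner_comm]
  exact mul_nonneg (sub_nonneg.2 h)
    ((sq_nonneg _).trans (hK.sq_norm_le_inner_neumann_neumann h hm' x))

/-- The increment is `m' - m` times the form of a nonnegative symmetric operator, so Cauchy–Schwarz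
bounds off-diagonal increments by diagonal ones. -/
lemma sq_norm_weylForm_sub_le (hK : IsFirmlyNonexpansive K) {m m' : ℝ} (h : m ≤ m') (hm' : m' < 1)
    (x y : H) : ‖weylForm K m' x y - weylForm K m x y‖ ^ 2 ≤
      ((weylForm K m' x x).re - (weylForm K m x x).re) *
        ((weylForm K m' y y).re - (weylForm K m y y).re) := by
  have hm := h.trans_lt hm'
  have hc := sq_norm_inner_le_of_symmetric LinearMap.id
    (neumann K m' ∘L neumann K m).toLinearMap
    (fun x y => by
      simp only [ContinuousLinearMap.coe_coe, ContinuousLinearMap.comp_apply, LinearMap.id_apply]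
      rw [hK.neumann_symm hm', hK.neumann_symm hm, hK.neumann_comm hm hm'])
    (fun x => (sq_nonneg _).trans (hK.sq_norm_le_inner_neumann_neumann h hm' x)) y x
  simp only [ContinuousLinearMap.coe_coe, ContinuousLinearMap.comp_apply, LinearMap.id_apply] at hc
  simp only [← Complex.sub_re, hK.weylForm_sub hm hm', Complex.re_ofReal_mul, norm_mul, mul_pow,
    Complex.norm_real, Real.norm_eq_abs, sq_abs]
  rw [norm_inner_symm, re_inner_comm x, re_inner_comm y]
  nlinarith [mul_le_mul_of_nonneg_left hc (sq_nonneg (m' - m))]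

end IsFirmlyNonexpansive

end SingularPerturbation

namespace SingularPerturbation

/-! ### Finite families of vectors and their biorthogonal families -/

section HilbertSpace

variable {H : Type*} [NormedAddCommGroup H] [InnerProductSpace ℂ H] {n : ℕ}

lemma inner_sum_smul (h : Fin n → H) (α : Fin n → ℂ) (y : H) :
    ⟪∑ p, α p • h p, y⟫_ℂ = ∑ p, conj (α p) * ⟪h p, y⟫_ℂ := by
  simp [mul_comm]

/-- A vector orthogonal to the common kernel of the functionals `(h_j, ·)` is a combination of the
`h_j`. -/
lemma exists_eq_sum_smul_of_orthogonal (h : Fin n → H) (z : H)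
    (hz : ∀ y, (∀ j, ⟪h j, y⟫_ℂ = 0) → ⟪z, y⟫_ℂ = 0) : ∃ c : Fin n → ℂ, ∑ j, c j • h j = z := by
  rw [← Submodule.mem_span_range_iff_exists_fun]
  have : FiniteDimensional ℂ (Submodule.span ℂ (Set.range h)) :=
    FiniteDimensional.span_of_finite ℂ (Set.finite_range h)
  rw [← Submodule.orthogonal_orthogonal (Submodule.span ℂ (Set.range h)),
    Submodule.mem_orthogonal']
  intro y hy
  exact hz y fun j => (Submodule.mem_orthogonal _ _).1 hy _ (Submodule.subset_span ⟨j, rfl⟩)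

lemma exists_dual_family {h : Fin n → H} (hh : LinearIndependent ℂ h) :
    ∃ b : Fin n → H, ∀ i j, ⟪h i, b j⟫_ℂ = if i = j then 1 else 0 := by
  have key : ∀ j, ∃ b : H, ∀ i, ⟪h i, b⟫_ℂ = if i = j then 1 else 0 := by
    intro j
    have hj := linearIndependent_iff_notMem_span.1 hh j
    have : FiniteDimensional ℂ (Submodule.span ℂ (h '' (Set.univ \ {j}))) :=
      FiniteDimensional.span_of_finite ℂ (Set.toFinite _)
    rw [← Submodule.orthogonal_orthogonal (Submodule.span ℂ (h '' (Set.univ \ {j}))),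
      Submodule.mem_orthogonal'] at hj
    push Not at hj
    obtain ⟨v, hv, hv'⟩ := hj
    refine ⟨(⟪h j, v⟫_ℂ)⁻¹ • v, fun i => ?_⟩
    rw [inner_smul_right]
    split_ifs with hij
    · rw [hij, inv_mul_cancel₀ hv']
    · rw [(Submodule.mem_orthogonal _ _).1 hv _ (Submodule.subset_span ⟨i, by simpa using hij, rfl⟩),
        mul_zero]
  choose b hb using key
  exact ⟨b, fun i j => hb j i⟩

end HilbertSpace

variable {H : Type*} [NormedAddCommGroup H] [InnerProductSpace ℂ H] [CompleteSpace H]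

/-! ### The resolvent of a nonnegative self-adjoint operator -/

section Resolvent

variable {A : H →ₗ.[ℂ] H}

omit [CompleteSpace H] in
lemma shift_apply (u : A.domain) : shift A u = A u + u := rfl

lemma inner_apply_eq_of_isSelfAdjoint (hA : IsSelfAdjoint A) (u v : A.domain) :
    ⟪A u, (v : H)⟫_ℂ = ⟪(u : H), A v⟫_ℂ := by
  have h := LinearPMap.adjoint_isFormalAdjoint hA.dense_domain
  rw [show A.adjoint = A from hA] at h
  exact h u v

lemma resolvent_mem (hA : IsSelfAdjoint A) (hpos : IsNonneg A) (y : H) :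
    resolvent A y ∈ A.domain := by
  obtain ⟨u, hu, -⟩ := (resolvent_spec hA hpos y _).1 rfl
  exact hu ▸ u.2

lemma shift_resolvent (hA : IsSelfAdjoint A) (hpos : IsNonneg A) (y : H)
    (hy : resolvent A y ∈ A.domain) : shift A ⟨resolvent A y, hy⟩ = y := by
  obtain ⟨u, hu, hu'⟩ := (resolvent_spec hA hpos y _).1 rfl
  rw [show (⟨resolvent A y, hy⟩ : A.domain) = u from Subtype.ext hu.symm, hu']

lemma resolvent_shift (hA : IsSelfAdjoint A) (hpos : IsNonneg A) (u : A.domain) :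
    resolvent A (shift A u) = u :=
  (resolvent_spec hA hpos _ _).2 ⟨u, rfl, rfl⟩

lemma apply_resolvent (hA : IsSelfAdjoint A) (hpos : IsNonneg A) (y : H)
    (hy : resolvent A y ∈ A.domain) : A ⟨resolvent A y, hy⟩ = y - resolvent A y :=
  eq_sub_of_add_eq (shift_resolvent hA hpos y hy)

lemma resolvent_injective (hA : IsSelfAdjoint A) (hpos : IsNonneg A) :
    Function.Injective (resolvent A) := by
  intro x y hxy
  rw [← shift_resolvent hA hpos x (resolvent_mem hA hpos x),
    ← shift_resolvent hA hpos y (resolvent_mem hA hpos y)]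
  congr 1
  exact Subtype.ext hxy

lemma isFirmlyNonexpansive_resolvent (hA : IsSelfAdjoint A) (hpos : IsNonneg A) :
    IsFirmlyNonexpansive (resolvent A) where
  symm x y := by
    have h := inner_apply_eq_of_isSelfAdjoint hA ⟨_, resolvent_mem hA hpos x⟩
      ⟨_, resolvent_mem hA hpos y⟩
    rw [apply_resolvent hA hpos, apply_resolvent hA hpos, inner_sub_left, inner_sub_right] at h
    exact (sub_left_inj.1 h).symm
  sq_le x := by
    have h := hpos ⟨_, resolvent_mem hA hpos x⟩
    rw [apply_resolvent hA hpos, inner_sub_left, Complex.sub_re, re_inner_self,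
      re_inner_comm] at h
    linarith

lemma sq_norm_sqrtResolvent (hA : IsSelfAdjoint A) (hpos : IsNonneg A) (y : H) :
    ‖sqrtResolvent A y‖ ^ 2 = (⟪resolvent A y, y⟫_ℂ).re := by
  have hK := isFirmlyNonexpansive_resolvent hA hpos
  have h0 : 0 ≤ resolvent A := by
    rw [ContinuousLinearMap.nonneg_iff_isPositive]
    exact ⟨fun x y => hK.symm x y, fun x => hK.nonneg x⟩
  have hS : (sqrtResolvent A).IsPositive := by
    rw [← ContinuousLinearMap.nonneg_iff_isPositive]
    exact CFC.sqrt_nonneg _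
  have hSS : sqrtResolvent A * sqrtResolvent A = resolvent A := CFC.sqrt_mul_sqrt_self _ h0
  rw [← hSS, ← re_inner_self]
  exact congrArg Complex.re (hS.inner_left_eq_inner_right _ _).symm

lemma resolvent_eq_sqrtResolvent (hA : IsSelfAdjoint A) (hpos : IsNonneg A) (y : H) :
    resolvent A y = sqrtResolvent A (sqrtResolvent A y) := by
  have hK := isFirmlyNonexpansive_resolvent hA hpos
  have h0 : 0 ≤ resolvent A := by
    rw [ContinuousLinearMap.nonneg_iff_isPositive]
    exact ⟨fun x y => hK.symm x y, fun x => hK.nonneg x⟩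
  have hSS : sqrtResolvent A * sqrtResolvent A = resolvent A := CFC.sqrt_mul_sqrt_self _ h0
  conv_lhs => rw [← hSS]
  rfl

end Resolvent

/-! ### The spaces `H₋₁` and `H₋₂` and extensions by continuity -/

section Completion

variable (A : H →ₗ.[ℂ] H)

omit [CompleteSpace H] in
lemma isometry_toH (S : H →L[ℂ] H) : Isometry (Renormed.toH S) :=
  AddMonoidHomClass.isometry_of_norm _ fun _ => rfl

omit [CompleteSpace H] in
lemma extResolvent_coe (u : Renormed (resolvent A)) :
    extResolvent A u = Renormed.toH (resolvent A) u :=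
  UniformSpace.Completion.extension_coe (isometry_toH _).uniformContinuous u

lemma continuous_extResolvent : Continuous (extResolvent A) :=
  UniformSpace.Completion.continuous_extension

lemma extResolvent_add (φ ψ : HNegTwo A) :
    extResolvent A (φ + ψ) = extResolvent A φ + extResolvent A ψ := by
  have hc := continuous_extResolvent A
  induction φ, ψ using UniformSpace.Completion.induction_on₂ with
  | hp => exact isClosed_eq (by fun_prop) (by fun_prop)
  | ih a b =>
    rw [← UniformSpace.Completion.coe_add]
    simp only [extResolvent_coe, map_add]

lemma extResolvent_smul (c : ℂ) (ψ : HNegTwo A) :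
    extResolvent A (c • ψ) = c • extResolvent A ψ := by
  have hc := continuous_extResolvent A
  induction ψ using UniformSpace.Completion.induction_on with
  | hp => exact isClosed_eq (hc.comp (continuous_const_smul c)) (hc.const_smul c)
  | ih a =>
    rw [← UniformSpace.Completion.coe_smul]
    simp only [extResolvent_coe, map_smul]

lemma norm_extResolvent (ψ : HNegTwo A) : ‖extResolvent A ψ‖ = ‖ψ‖ := by
  have hc := continuous_extResolvent A
  induction ψ using UniformSpace.Completion.induction_on with
  | hp => exact isClosed_eq (by fun_prop) (by fun_prop)
  | ih a =>
    rw [extResolvent_coe, UniformSpace.Completion.norm_coe]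
    rfl

/-- `(A + I)⁻¹ : H₋₂(A) → H` as a linear isometry. -/
noncomputable def extResolventₗᵢ : HNegTwo A →ₗᵢ[ℂ] H where
  toFun := extResolvent A
  map_add' := extResolvent_add A
  map_smul' := extResolvent_smul A
  norm_map' := norm_extResolvent A

lemma extResolvent_injective : Function.Injective (extResolvent A) :=
  (extResolventₗᵢ A).injective

lemma extResolvent_sum {n : ℕ} (c : Fin n → ℂ) (ψ : Fin n → HNegTwo A) :
    extResolvent A (∑ j, c j • ψ j) = ∑ j, c j • extResolvent A (ψ j) := by
  have := map_sum (extResolventₗᵢ A) (fun j => c j • ψ j) Finset.univ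
  simp only [map_smul] at this
  exact this

lemma linearIndependent_extResolvent {n : ℕ} {ψ : Fin n → HNegTwo A}
    (hψ : LinearIndependent ℂ ψ) : LinearIndependent ℂ fun j => extResolvent A (ψ j) :=
  hψ.map' (extResolventₗᵢ A).toLinearMap (LinearMap.ker_eq_bot.2 (extResolventₗᵢ A).injective)

variable {A}

/-- An element `ψ` of `H₋₂(A)` belongs to `H₋₁(A)` if it is the limit of vectors of `H` which form
a Cauchy sequence in `H₋₁(A)`. -/
lemma memHNegOne_of_cauchySeq (hA : IsSelfAdjoint A) (hpos : IsNonneg A) {ψ : HNegTwo A}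
    {y : ℕ → H} (hc : CauchySeq fun k => sqrtResolvent A (y k))
    (hlim : Tendsto (fun k => resolvent A (y k)) atTop (𝓝 (extResolvent A ψ))) :
    MemHNegOne A ψ := by
  let L : Renormed (sqrtResolvent A) →ₗ[ℂ] Renormed (resolvent A) :=
    (Renormed.of (resolvent A)).toLinearMap ∘ₗ (Renormed.of (sqrtResolvent A)).symm.toLinearMap
  -- `Completion.map` extends the given map only if that map is uniformly continuous; here the bound
  -- is `‖K u‖ ≤ ‖K^{1/2}‖ ‖K^{1/2} u‖`.
  have hL : UniformContinuous L := by
    refine AddMonoidHomClass.uniformContinuous_of_bound L ‖sqrtResolvent A‖ fun u => ?_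
    refine le_of_eq_of_le (congrArg (fun v : H => ‖v‖) (resolvent_eq_sqrtResolvent hA hpos
      ((Renormed.of (sqrtResolvent A)).symm u)) :) ?_
    exact (sqrtResolvent A).le_opNorm _
  let Y : ℕ → Renormed (sqrtResolvent A) := fun k => Renormed.of _ (y k)
  have hY : CauchySeq Y := by
    rw [Metric.cauchySeq_iff] at hc ⊢
    intro ε hε
    obtain ⟨N, hN⟩ := hc ε hε
    exact ⟨N, fun k hk l hl => by
      rw [← (isometry_toH (sqrtResolvent A)).dist_eq]; exact hN k hk l hl⟩
  have hY' : CauchySeq fun k => (Y k : HNegOne A) :=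
    (UniformSpace.Completion.uniformContinuous_coe _).comp_cauchySeq hY
  obtain ⟨Φ, hΦ⟩ := cauchySeq_tendsto_of_complete hY'
  refine ⟨Φ, extResolvent_injective A ?_⟩
  refine tendsto_nhds_unique ?_ hlim
  have h1 := ((continuous_extResolvent A).comp
    (UniformSpace.Completion.continuous_map (f := L))).continuousAt.tendsto.comp hΦ
  refine h1.congr fun k => ?_
  simp only [Function.comp_apply]
  rw [UniformSpace.Completion.map_coe hL, extResolvent_coe]
  rfl

lemma memHNegOne_coe (hA : IsSelfAdjoint A) (hpos : IsNonneg A) (z : H) :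
    MemHNegOne A ((Renormed.of (resolvent A) z : Renormed (resolvent A)) : HNegTwo A) :=
  memHNegOne_of_cauchySeq hA hpos (y := fun _ => z) (cauchySeq_const _) (by
    rw [extResolvent_coe]; exact tendsto_const_nhds)

/-- The commutation relation between `V` and the resolvent bounds `V` in the norm of `H₋₂`, so the
extension of `V` is genuine; the relation then passes from `H` to `H₋₂` by density. -/
lemma extResolvent_extUnitary (V : H ≃ₗᵢ[ℂ] H) (q : ℝ)
    (hV : ∀ x, resolvent A (V x) =
      (q : ℂ) • V (resolvent A x) - ((q - 1 : ℝ) : ℂ) • resolvent A (V (resolvent A x)))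
    (ψ : HNegTwo A) :
    extResolvent A (extUnitary A V ψ) = (q : ℂ) • V (extResolvent A ψ) -
      ((q - 1 : ℝ) : ℂ) • resolvent A (V (extResolvent A ψ)) := by
  let L : Renormed (resolvent A) →ₗ[ℂ] Renormed (resolvent A) :=
    (Renormed.of (resolvent A)).toLinearMap ∘ₗ V.toLinearEquiv.toLinearMap ∘ₗ
      (Renormed.of (resolvent A)).symm.toLinearMap
  have hL : UniformContinuous L := by
    refine AddMonoidHomClass.uniformContinuous_of_bound L (|q| + |q - 1| * ‖resolvent A‖) fun u => ?_
    refine le_of_eq_of_le (congrArg (fun v : H => ‖v‖) (hV ((Renormed.of (resolvent A)).symm u)) :) ?_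
    refine (norm_sub_le _ _).trans ?_
    rw [norm_smul, norm_smul, Complex.norm_real, Complex.norm_real, V.norm_map, add_mul,
      Real.norm_eq_abs, Real.norm_eq_abs, mul_assoc]
    refine add_le_add le_rfl (mul_le_mul_of_nonneg_left ?_ (abs_nonneg _))
    refine ((resolvent A).le_opNorm _).trans (le_of_eq ?_)
    rw [V.norm_map]
    rfl
  have hc := continuous_extResolvent A
  have hc' : Continuous (extUnitary A V) := UniformSpace.Completion.continuous_map (f := L)
  have hVc := V.continuous
  induction ψ using UniformSpace.Completion.induction_on with
  | hp => exact isClosed_eq (by fun_prop) (by fun_prop)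
  | ih a =>
    have h1 : extUnitary A V a = (L a : Renormed (resolvent A)) :=
      UniformSpace.Completion.map_coe hL a
    rw [h1, extResolvent_coe, extResolvent_coe]
    exact hV a

end Completion

end SingularPerturbation

/-! ### The symmetric restriction, its adjoint and the extensions given by a boundary matrix -/

namespace SingularPerturbation

variable {H : Type*} [NormedAddCommGroup H] [InnerProductSpace ℂ H] [CompleteSpace H]
variable {A : H →ₗ.[ℂ] H} {n : ℕ} {ψ : Fin n → HNegTwo A} {R : Matrix (Fin n) (Fin n) ℂ}

lemma pairing_resolvent (hA : IsSelfAdjoint A) (hpos : IsNonneg A) (φ : HNegTwo A) (y : H)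
    (hy : resolvent A y ∈ A.domain) :
    pairing A φ ⟨resolvent A y, hy⟩ = ⟪extResolvent A φ, y⟫_ℂ := by
  change ⟪extResolvent A φ, shift A ⟨resolvent A y, hy⟩⟫_ℂ = _
  rw [shift_resolvent hA hpos]

lemma mem_symOp_domain (hA : IsSelfAdjoint A) (hpos : IsNonneg A) {x : H} :
    x ∈ (symOp A ψ).domain ↔ ∃ y, (∀ j, ⟪extResolvent A (ψ j), y⟫_ℂ = 0) ∧ resolvent A y = x := by
  simp only [symOp, LinearPMap.domRestrict_domain, Submodule.mem_inf, Submodule.mem_map,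
    Submodule.mem_iInf, LinearMap.mem_ker]
  constructor
  · rintro ⟨⟨u, hu, rfl⟩, -⟩
    exact ⟨shift A u, hu, resolvent_shift hA hpos u⟩
  · rintro ⟨y, hy, rfl⟩
    refine ⟨⟨⟨_, resolvent_mem hA hpos y⟩, fun j => ?_, rfl⟩, resolvent_mem hA hpos y⟩
    rw [pairing_resolvent hA hpos, hy]

lemma symOp_apply (hA : IsSelfAdjoint A) (hpos : IsNonneg A) (y : H)
    (hy : resolvent A y ∈ (symOp A ψ).domain) :
    symOp A ψ ⟨resolvent A y, hy⟩ = y - resolvent A y := by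
  rw [← apply_resolvent hA hpos y (resolvent_mem hA hpos y)]
  exact LinearPMap.domRestrict_apply rfl

/-- If `z` is orthogonal to the domain, then `K z` is orthogonal to the common kernel of the `(h_j,
·)`, hence `K z = ∑ c_j h_j`. Injectivity of the extended resolvent gives `z = ∑ c_j ψ_j` in `H₋₂`,
so `z` lies in `X ∩ H₋₁ = {0}`. -/
lemma dense_symOp_domain (hA : IsSelfAdjoint A) (hpos : IsNonneg A)
    (hψ : ∀ φ ∈ Submodule.span ℂ (Set.range ψ), MemHNegOne A φ → φ = 0) :
    Dense ((symOp A ψ).domain : Set H) := by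
  rw [Submodule.dense_iff_topologicalClosure_eq_top, Submodule.topologicalClosure_eq_top_iff,
    Submodule.eq_bot_iff]
  intro z hz
  obtain ⟨c, hc⟩ := exists_eq_sum_smul_of_orthogonal (fun j => extResolvent A (ψ j))
    (resolvent A z) fun y hy => by
      rw [(isFirmlyNonexpansive_resolvent hA hpos).symm]
      exact (Submodule.mem_orthogonal' _ _).1 hz _ ((mem_symOp_domain hA hpos).2 ⟨y, hy, rfl⟩)
  have h1 : extResolvent A (∑ j, c j • ψ j) =
      extResolvent A ((Renormed.of (resolvent A) z : Renormed (resolvent A)) : HNegTwo A) := by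
    rw [extResolvent_sum, extResolvent_coe, hc]
    rfl
  have h2 := extResolvent_injective A h1
  have h3 : ∑ j, c j • ψ j = 0 := by
    refine hψ _ ?_ (h2 ▸ memHNegOne_coe hA hpos z)
    exact Submodule.sum_mem _ fun j _ => Submodule.smul_mem _ _ (Submodule.subset_span ⟨j, rfl⟩)
  refine resolvent_injective hA hpos ?_
  rw [map_zero, ← hc, ← extResolvent_sum, h3]
  exact map_zero (extResolventₗᵢ A)

lemma inner_eq_inner_symOp (hA : IsSelfAdjoint A) (hpos : IsNonneg A) (y : H) (α : Fin n → ℂ)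
    (x : (symOp A ψ).domain) :
    ⟪y - (resolvent A y + ∑ p, α p • extResolvent A (ψ p)), (x : H)⟫_ℂ =
      ⟪resolvent A y + ∑ p, α p • extResolvent A (ψ p), symOp A ψ x⟫_ℂ := by
  obtain ⟨x, hx⟩ := x
  obtain ⟨z, hz, rfl⟩ := (mem_symOp_domain hA hpos).1 hx
  rw [symOp_apply hA hpos, inner_sub_left, inner_sub_right, inner_add_left _ _ z, inner_sum_smul,
    (isFirmlyNonexpansive_resolvent hA hpos).symm]
  simp [hz]

lemma mem_adjoint_domain (hA : IsSelfAdjoint A) (hpos : IsNonneg A) (y : H) (α : Fin n → ℂ) :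
    resolvent A y + ∑ p, α p • extResolvent A (ψ p) ∈ (symOp A ψ).adjoint.domain :=
  LinearPMap.mem_adjoint_domain_of_exists _ ⟨_, inner_eq_inner_symOp hA hpos y α⟩

lemma adjoint_symOp_apply (hA : IsSelfAdjoint A) (hpos : IsNonneg A)
    (hd : Dense ((symOp A ψ).domain : Set H)) (f : (symOp A ψ).adjoint.domain) {y : H}
    {α : Fin n → ℂ} (hf : (f : H) = resolvent A y + ∑ p, α p • extResolvent A (ψ p)) :
    (symOp A ψ).adjoint f = y - f :=
  LinearPMap.adjoint_apply_eq hd f (by rw [hf]; exact inner_eq_inner_symOp hA hpos y α)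

/-- The vector `f - K (w + f)` is orthogonal to the common kernel of the `(h_j, ·)`. This is the
inclusion of `D(A_sym*)` in `D(A) + span {h_p}`. -/
lemma exists_of_inner_eq (hA : IsSelfAdjoint A) (hpos : IsNonneg A) {f w : H}
    (hf : ∀ x : (symOp A ψ).domain, ⟪w, (x : H)⟫_ℂ = ⟪f, symOp A ψ x⟫_ℂ) :
    ∃ α : Fin n → ℂ, f = resolvent A (w + f) + ∑ p, α p • extResolvent A (ψ p) := by
  obtain ⟨c, hc⟩ := exists_eq_sum_smul_of_orthogonal (fun j => extResolvent A (ψ j))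
    (f - resolvent A (w + f)) fun y hy => by
      have h := hf ⟨_, (mem_symOp_domain hA hpos).2 ⟨y, hy, rfl⟩⟩
      rw [symOp_apply hA hpos, inner_sub_right] at h
      rw [inner_sub_left, (isFirmlyNonexpansive_resolvent hA hpos).symm, inner_add_left, h]
      ring
  exact ⟨c, by rw [hc]; abel⟩

omit [CompleteSpace H] in
lemma compose_apply (u : A.domain) (α : Fin n → ℂ) :
    compose A ψ (u, α) = u + ∑ p, α p • extResolvent A (ψ p) := by
  simp [compose, Fintype.linearCombination_apply]

lemma exPairing_resolvent (hA : IsSelfAdjoint A) (hpos : IsNonneg A) (y : H)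
    (hy : resolvent A y ∈ A.domain) (α : Fin n → ℂ) (i : Fin n) :
    exPairing A ψ R (⟨resolvent A y, hy⟩, α) i = ⟪extResolvent A (ψ i), y⟫_ℂ + R.mulVec α i := by
  simp [exPairing, pairing_resolvent hA hpos]

lemma mem_extensionOf (hA : IsSelfAdjoint A) (hpos : IsNonneg A) {f : H} :
    f ∈ (extensionOf A ψ R).domain ↔ ∃ (y : H) (α : Fin n → ℂ),
      (∀ i, ⟪extResolvent A (ψ i), y⟫_ℂ + R.mulVec α i = 0) ∧
        f = resolvent A y + ∑ p, α p • extResolvent A (ψ p) := by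
  simp only [extensionOf, LinearPMap.domRestrict_domain, Submodule.mem_inf, Submodule.mem_map,
    LinearMap.mem_ker]
  constructor
  · rintro ⟨⟨⟨u, α⟩, hu, rfl⟩, -⟩
    refine ⟨shift A u, α, fun i => ?_, ?_⟩
    · rw [← exPairing_resolvent hA hpos _ (resolvent_mem hA hpos _)]
      rw [show (⟨resolvent A (shift A u), resolvent_mem hA hpos _⟩ : A.domain) = u from
        Subtype.ext (resolvent_shift hA hpos u), hu]
      rfl
    · rw [compose_apply, resolvent_shift hA hpos]
  · rintro ⟨y, α, h, rfl⟩
    refine ⟨⟨(⟨_, resolvent_mem hA hpos y⟩, α), ?_, compose_apply _ _⟩,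
      mem_adjoint_domain hA hpos y α⟩
    funext i
    rw [exPairing_resolvent hA hpos, h]
    rfl

lemma extensionOf_apply (hA : IsSelfAdjoint A) (hpos : IsNonneg A)
    (hd : Dense ((symOp A ψ).domain : Set H)) (f : (extensionOf A ψ R).domain) {y : H}
    {α : Fin n → ℂ} (hf : (f : H) = resolvent A y + ∑ p, α p • extResolvent A (ψ p)) :
    extensionOf A ψ R f = y - f := by
  have hf' : (f : H) ∈ (symOp A ψ).adjoint.domain := hf ▸ mem_adjoint_domain hA hpos y α
  rw [← adjoint_symOp_apply hA hpos hd ⟨f, hf'⟩ hf]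
  exact LinearPMap.domRestrict_apply rfl

lemma symOp_le_extensionOf (hA : IsSelfAdjoint A) (hpos : IsNonneg A)
    (hd : Dense ((symOp A ψ).domain : Set H)) : symOp A ψ ≤ extensionOf A ψ R := by
  refine ⟨fun x hx => ?_, ?_⟩
  · obtain ⟨y, hy, rfl⟩ := (mem_symOp_domain hA hpos).1 hx
    exact (mem_extensionOf hA hpos).2 ⟨y, 0, by simpa using hy, by simp⟩
  · rintro ⟨x, hx⟩ f hxf
    obtain ⟨y, hy, rfl⟩ := (mem_symOp_domain hA hpos).1 hx
    rw [symOp_apply hA hpos, extensionOf_apply hA hpos hd f (y := y) (α := 0) (by simp [← hxf]),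
      ← hxf]

/-- Green's formula for the adjoint of `A_sym`. -/
lemma inner_sub_inner_eq (hA : IsSelfAdjoint A) (hpos : IsNonneg A) {h : Fin n → H} {f g x y : H}
    {α β : Fin n → ℂ} (hf : f = resolvent A y + ∑ p, α p • h p)
    (hg : g = resolvent A x + ∑ p, β p • h p) :
    ⟪y - f, g⟫_ℂ - ⟪f, x - g⟫_ℂ = ∑ p, β p * conj ⟪h p, y⟫_ℂ - ∑ p, conj (α p) * ⟪h p, x⟫_ℂ := by
  have h1 : ⟪y, ∑ p, β p • h p⟫_ℂ = ∑ p, β p * conj ⟪h p, y⟫_ℂ := by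
    simp
  rw [inner_sub_left, inner_sub_right, ← h1, ← inner_sum_smul]
  have h2 : ⟪y, g⟫_ℂ = ⟪resolvent A y, x⟫_ℂ + ⟪y, ∑ p, β p • h p⟫_ℂ := by
    rw [hg, inner_add_right, (isFirmlyNonexpansive_resolvent hA hpos).symm]
  have h3 : ⟪f, x⟫_ℂ = ⟪resolvent A y, x⟫_ℂ + ⟪∑ p, α p • h p, x⟫_ℂ := by
    rw [hf, inner_add_left]
  linear_combination h2 - h3

omit [CompleteSpace H] in
lemma exists_inner_eq {h : Fin n → H} (hh : LinearIndependent ℂ h) (c : Fin n → ℂ) :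
    ∃ y : H, ∀ i, ⟪h i, y⟫_ℂ = c i := by
  obtain ⟨b, hb⟩ := exists_dual_family hh
  exact ⟨∑ j, c j • b j, fun i => by simp [hb]⟩

lemma isSelfAdjoint_extensionOf (hA : IsSelfAdjoint A) (hpos : IsNonneg A)
    (hd : Dense ((symOp A ψ).domain : Set H)) (hψ : LinearIndependent ℂ ψ) (hR : R.IsHermitian) :
    IsSelfAdjoint (extensionOf A ψ R) := by
  have hle := symOp_le_extensionOf (R := R) hA hpos hd
  have hdN : Dense ((extensionOf A ψ R).domain : Set H) := hd.mono hle.1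
  have hRc : ∀ i j, conj (R i j) = R j i := fun i j => hR.apply j i
  have hfa : (extensionOf A ψ R).IsFormalAdjoint (extensionOf A ψ R) := by
    intro f g
    obtain ⟨y, α, hy, hf⟩ := (mem_extensionOf hA hpos).1 f.2
    obtain ⟨x, β, hx, hg⟩ := (mem_extensionOf hA hpos).1 g.2
    rw [extensionOf_apply hA hpos hd f hf, extensionOf_apply hA hpos hd g hg, ← sub_eq_zero,
      inner_sub_inner_eq hA hpos hf hg]
    simp only [fun i => eq_neg_of_add_eq_zero_left (hy i),
      fun i => eq_neg_of_add_eq_zero_left (hx i), map_neg, mul_neg, Finset.sum_neg_distrib,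
      Matrix.mulVec, dotProduct, map_sum, map_mul, hRc, Finset.mul_sum]
    rw [Finset.sum_comm, neg_sub_neg, sub_eq_zero]
    exact Finset.sum_congr rfl fun i _ => Finset.sum_congr rfl fun j _ => by ring
  refine (LinearPMap.eq_of_le_of_domain_eq (LinearPMap.IsFormalAdjoint.le_adjoint hdN hfa) ?_).symm
  refine le_antisymm (LinearPMap.IsFormalAdjoint.le_adjoint hdN hfa).1 fun f hf => ?_
  have hN := LinearPMap.adjoint_isFormalAdjoint hdN ⟨f, hf⟩
  set w := (extensionOf A ψ R).adjoint ⟨f, hf⟩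
  obtain ⟨β, hβ⟩ := exists_of_inner_eq (ψ := ψ) (f := f) (w := w) hA hpos fun x => by
    rw [hle.2 (y := ⟨x, hle.1 x.2⟩) rfl]
    exact hN ⟨x, hle.1 x.2⟩
  refine (mem_extensionOf hA hpos).2 ⟨w + f, β, fun i => ?_, hβ⟩
  -- A test vector in the domain whose defect coordinates are the `i`-th unit vector: Green's
  -- formula against it isolates the `i`-th boundary condition for `f`.
  obtain ⟨y, hy⟩ := exists_inner_eq (linearIndependent_extResolvent A hψ)
    (-(R.mulVec (Pi.single i 1)))
  have hg := (mem_extensionOf (R := R) (ψ := ψ) hA hpos).2 ⟨y, Pi.single i 1, fun j => by simp [hy], rfl⟩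
  have h1 := hN ⟨_, hg⟩
  rw [extensionOf_apply hA hpos hd ⟨_, hg⟩ rfl] at h1
  have h2 := inner_sub_inner_eq hA hpos hβ (x := y) (β := Pi.single i 1) rfl
  rw [add_sub_cancel_right, h1] at h2
  simp only [sub_self, hy, Matrix.mulVec_single_one, Pi.neg_apply, Pi.single_apply, ite_mul,
    one_mul, zero_mul, Finset.sum_ite_eq', Finset.mem_univ, if_true, Matrix.col_apply, mul_neg,
    Finset.sum_neg_distrib, sub_neg_eq_add] at h2
  have h3 := congrArg conj h2.symm
  simp only [map_add, map_sum, map_mul, Complex.conj_conj, hRc, map_zero] at h3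
  rw [Matrix.mulVec, dotProduct, ← h3]
  simp only [mul_comm]

end SingularPerturbation

/-! ### Scaling of defect vectors, of the Weyl form and of boundary values -/

namespace SingularPerturbation

variable {H : Type*} [NormedAddCommGroup H] [InnerProductSpace ℂ H]

/-- The relations between a unitary operator `V` with `V A = q A V`, the resolvent
`K = (A + I)⁻¹`, and the defect vectors `h_j = (A + I)⁻¹ ψ_j` of eigenvectors `ψ_j` of `V`. -/
structure IsScaling {n : ℕ} (K : H →L[ℂ] H) (h : Fin n → H) (V : H ≃ₗᵢ[ℂ] H) (q : ℝ)
    (ξ : Fin n → ℝ) : Prop where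
  pos : 0 < q
  ne_zero : ∀ j, ξ j ≠ 0
  map_apply : ∀ x, (q : ℂ) • V (K x) = K (V x) + ((q : ℂ) - 1) • K (V (K x))
  map_vec : ∀ j, (q : ℂ) • V (h j) = (ξ j : ℂ) • h j + ((q : ℂ) - 1) • K (V (h j))
  symm_vec : ∀ j, V.symm (h j) =
    ((q : ℂ) / ξ j) • h j + (1 - (q : ℂ)) • K (V.symm (h j))

namespace IsScaling

variable {n : ℕ} {K : H →L[ℂ] H} {h : Fin n → H} {V : H ≃ₗᵢ[ℂ] H} {q : ℝ} {ξ : Fin n → ℝ}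

lemma inner_map (x y : H) : ⟪x, V y⟫_ℂ = ⟪V.symm x, y⟫_ℂ := by
  rw [← V.inner_map_map (V.symm x), V.apply_symm_apply]

lemma sq_eq_one (hs : IsScaling K h V q ξ) (hq : q = 1) (j : Fin n) (hj : h j ≠ 0) :
    ξ j ^ 2 = 1 := by
  have h1 := congrArg norm (hs.map_vec j)
  rw [hq] at h1
  simp only [Complex.ofReal_one, one_smul, sub_self, zero_smul, add_zero, V.norm_map, norm_smul,
    Complex.norm_real, Real.norm_eq_abs] at h1
  have h2 : |ξ j| = 1 := mul_right_cancel₀ (norm_ne_zero_iff.2 hj) (by rw [one_mul]; exact h1.symm)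
  rw [← sq_abs, h2, one_pow]

variable [CompleteSpace H]

/-- With `λ = m - 1` and `λ' = m' - 1` the condition reads `λ = q λ'`: the defect vector at `λ` is
carried to a multiple of the one at `λ / q`. -/
lemma map_neumann (hs : IsScaling K h V q ξ) (hK : IsFirmlyNonexpansive K) {m m' : ℝ}
    (hm : m < 1) (hmm : q * (1 - m') = 1 - m) (j : Fin n) :
    (q : ℂ) • V (neumann K m (h j)) = (ξ j : ℂ) • neumann K m' (h j) := by
  have hm' : m' < 1 := by
    have := hs.pos
    by_contra! hc
    nlinarith
  rw [← map_smul (neumann K m')]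
  refine (hK.neumann_eq hm' ?_).symm
  set e := neumann K m (h j) with he
  have h1 : h j = e - (m : ℂ) • K e := (hK.neumann_sub hm _).symm
  have h2 : (q : ℂ) * m' = q + m - 1 := by
    have : q * m' = q + m - 1 := by linarith
    exact_mod_cast this
  have h3 := hs.map_vec j
  have h4 := hs.map_apply e
  have h5 : V (h j) = V e - (m : ℂ) • V (K e) := by rw [h1, map_sub, map_smul]
  rw [h5] at h3
  simp only [map_sub, map_smul] at h3 ⊢
  have h6 : (m' : ℂ) • (q : ℂ) • K (V e) = ((q : ℂ) + m - 1) • K (V e) := by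
    rw [smul_smul, mul_comm, h2]
  rw [h6]
  linear_combination (norm := module) h3 + (m : ℂ) • h4

/-- One factor comes from moving the defect vector by `V`, the other from moving `h_i` by `V⁻¹`. The
additive term is independent of `m`, so a suitable constant matrix can absorb it. -/
lemma weylForm_eq (hs : IsScaling K h V q ξ) (hK : IsFirmlyNonexpansive K) {m m' : ℝ}
    (hm : m < 1) (hmm : q * (1 - m') = 1 - m) (i j : Fin n) :
    weylForm K m' (h i) (h j) = ((q : ℂ) / (ξ i * ξ j)) * weylForm K m (h i) (h j) -
      (1 - (q : ℂ)) / ξ j * ⟪h i, V (h j)⟫_ℂ := by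
  have hq : (q : ℂ) ≠ 0 := by exact_mod_cast hs.pos.ne'
  have hi : (ξ i : ℂ) ≠ 0 := by exact_mod_cast hs.ne_zero i
  have hj : (ξ j : ℂ) ≠ 0 := by exact_mod_cast hs.ne_zero j
  have h2 : (q : ℂ) * m' = q + m - 1 := by
    have : q * m' = q + m - 1 := by linarith
    exact_mod_cast this
  set e := neumann K m (h j) with he
  have h1 : (m : ℂ) • K e = e - h j := by
    rw [eq_sub_iff_add_eq, ← eq_sub_iff_add_eq']
    exact (hK.neumann_sub hm _).symm
  have e1 : (ξ j : ℂ) * ⟪h i, neumann K m' (h j)⟫_ℂ = q * ⟪V.symm (h i), e⟫_ℂ := by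
    rw [← inner_smul_right, ← hs.map_neumann hK hm hmm, inner_smul_right, inner_map]
  have e2 : (m : ℂ) * ⟪V.symm (h i), K e⟫_ℂ = ⟪V.symm (h i), e⟫_ℂ - ⟪h i, V (h j)⟫_ℂ := by
    rw [← inner_smul_right, h1, inner_sub_right, inner_map]
  have e3 : ⟪V.symm (h i), e⟫_ℂ = (q : ℂ) / ξ i * ⟪h i, e⟫_ℂ +
      (1 - (q : ℂ)) * ⟪V.symm (h i), K e⟫_ℂ := by
    conv_lhs => rw [hs.symm_vec i]
    rw [inner_add_left, inner_smul_left, inner_smul_left, hK.symm]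
    simp
  rw [weylForm, weylForm]
  rw [div_mul_eq_mul_div, ← sub_eq_zero] at e3
  field_simp at e3 ⊢
  have hx := mul_right_cancel₀ hq (b := q) (a := (m' : ℂ) * ξ i * (ξ j * ⟪h i, neumann K m' (h j)⟫_ℂ))
    (c := m * (q * ⟪h i, e⟫_ℂ) - (1 - q) * ξ i * ⟪h i, V (h j)⟫_ℂ) (by
      rw [e1]
      linear_combination (ξ i * q * ⟪V.symm (h i), e⟫_ℂ) * h2 + q * m * e3 +
        q * (1 - q) * ξ i * e2)
  linear_combination hx

omit [CompleteSpace H] in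
/-- The transformed decomposition `V (K y + ∑ α_p h_p) = K y' + ∑ α'_p h_p`. -/
lemma map_add_sum (hs : IsScaling K h V q ξ) {f y : H} {α : Fin n → ℂ}
    (hf : f = K y + ∑ p, α p • h p) :
    V f = K ((q : ℂ)⁻¹ • (V y + ((q : ℂ) - 1) • V f)) + ∑ p, ((q : ℂ)⁻¹ * (ξ p * α p)) • h p := by
  have hq : (q : ℂ) ≠ 0 := by exact_mod_cast hs.pos.ne'
  have h1 : (q : ℂ) • V f = K (V y) + ((q : ℂ) - 1) • K (V f) + ∑ p, ((ξ p : ℂ) * α p) • h p := by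
    have h2 : (q : ℂ) • V (∑ p, α p • h p) =
        ∑ p, ((ξ p : ℂ) * α p) • h p + ((q : ℂ) - 1) • K (V (∑ p, α p • h p)) := by
      simp only [map_sum, map_smul, Finset.smul_sum, ← Finset.sum_add_distrib]
      refine Finset.sum_congr rfl fun p _ => ?_
      linear_combination (norm := module) (α p) • hs.map_vec p
    rw [hf]
    simp only [map_add, smul_add]
    linear_combination (norm := module) hs.map_apply y + h2
  rw [map_smul, map_add, map_smul]
  have h3 : ∑ p, ((q : ℂ)⁻¹ * (ξ p * α p)) • h p = (q : ℂ)⁻¹ • ∑ p, ((ξ p : ℂ) * α p) • h p := by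
    simp only [Finset.smul_sum, smul_smul]
  rw [h3, ← smul_add, ← h1, smul_smul, inv_mul_cancel₀ hq, one_smul]

omit [CompleteSpace H] in
-- The boundary values of `V f` are multiples of those of `f`, up to the error of `R` in the scaling
-- equations. Hence the boundary condition is preserved exactly when this error vanishes; both
-- directions are used.
lemma inner_add_mulVec (hs : IsScaling K h V q ξ) (hK : IsFirmlyNonexpansive K)
    (R : Matrix (Fin n) (Fin n) ℂ) {f y : H} {α : Fin n → ℂ}
    (hf : f = K y + ∑ p, α p • h p) (i : Fin n) :
    (q : ℂ) * (⟪h i, (q : ℂ)⁻¹ • (V y + ((q : ℂ) - 1) • V f)⟫_ℂ +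
        R.mulVec (fun p => (q : ℂ)⁻¹ * (ξ p * α p)) i) =
      (q : ℂ) / ξ i * (⟪h i, y⟫_ℂ + R.mulVec α i) +
        ∑ p, α p * ((ξ p - (q : ℂ) / ξ i) * R i p - (1 - (q : ℂ)) * ⟪h i, V (h p)⟫_ℂ) := by
  have hq : (q : ℂ) ≠ 0 := by exact_mod_cast hs.pos.ne'
  have e1 : ⟪h i, V y⟫_ℂ = (q : ℂ) / ξ i * ⟪h i, y⟫_ℂ + (1 - (q : ℂ)) * ⟪h i, V (K y)⟫_ℂ := by
    rw [inner_map, inner_map]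
    conv_lhs => rw [hs.symm_vec i]
    rw [inner_add_left, inner_smul_left, inner_smul_left, hK.symm]
    simp
  have e2 : ⟪h i, V f⟫_ℂ = ⟪h i, V (K y)⟫_ℂ + ∑ p, α p * ⟪h i, V (h p)⟫_ℂ := by
    rw [hf, map_add, inner_add_right]
    simp [map_sum, inner_sum, inner_smul_right]
  have e3 : R.mulVec (fun p => (q : ℂ)⁻¹ * (ξ p * α p)) i =
      (q : ℂ)⁻¹ * ∑ p, α p * (ξ p * R i p) := by
    rw [Matrix.mulVec, dotProduct, Finset.mul_sum]
    exact Finset.sum_congr rfl fun p _ => by ring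
  have e4 : R.mulVec α i = ∑ p, α p * R i p := by
    rw [Matrix.mulVec, dotProduct]
    exact Finset.sum_congr rfl fun p _ => mul_comm _ _
  have e5 : ∑ p, α p * ((ξ p - (q : ℂ) / ξ i) * R i p - (1 - (q : ℂ)) * ⟪h i, V (h p)⟫_ℂ) =
      ∑ p, α p * (ξ p * R i p) - (q : ℂ) / ξ i * ∑ p, α p * R i p -
        (1 - (q : ℂ)) * ∑ p, α p * ⟪h i, V (h p)⟫_ℂ := by
    simp only [Finset.mul_sum, ← Finset.sum_sub_distrib]
    exact Finset.sum_congr rfl fun p _ => by ring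
  rw [e3, e4, e5, inner_smul_right, inner_add_right, inner_smul_right, e2, e1, mul_add,
    mul_inv_cancel_left₀ hq, mul_inv_cancel_left₀ hq]
  ring

end IsScaling

end SingularPerturbation

/-! ### Homogeneity and the scaling equations -/

namespace SingularPerturbation

variable {H : Type*} [NormedAddCommGroup H] [InnerProductSpace ℂ H] [CompleteSpace H]
variable {A : H →ₗ.[ℂ] H} {n : ℕ} {ψ : Fin n → HNegTwo A} {R : Matrix (Fin n) (Fin n) ℂ}
variable {T : Set ℝ} {U : T → H ≃ₗᵢ[ℂ] H} {p : T → ℝ}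

namespace IsHomogeneous

omit [CompleteSpace H] in
lemma scale_ne_zero (hp : IsHomogeneous U p A) (t : T) : p t ≠ 0 := by
  intro h0
  obtain ⟨x, hx⟩ := hp.ne_zero
  have h := hp.map_eq t x
  rw [h0, Complex.ofReal_zero, zero_smul, map_eq_zero_iff _ (U t).injective] at h
  exact hx h

/-- A nonpositive factor would give `(A x, x) ≤ 0`, and Cauchy–Schwarz for the form of `A` would
then force `A x = 0` for all `x`. -/
lemma scale_pos (hp : IsHomogeneous U p A) (hA : IsSelfAdjoint A) (hpos : IsNonneg A) (t : T) :
    0 < p t := by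
  by_contra! hneg
  obtain ⟨x, hx⟩ := hp.ne_zero
  have h0 : (⟪A x, (x : H)⟫_ℂ).re ≤ 0 := by
    rw [← (U t).inner_map_map, hp.map_eq t x, inner_smul_left, Complex.conj_ofReal,
      Complex.re_ofReal_mul]
    exact mul_nonpos_of_nonpos_of_nonneg hneg (hpos ⟨U t x, (hp.mem_iff t x).1 x.2⟩)
  refine hx (hA.dense_domain.eq_zero_of_inner_left ℂ fun y hy => ?_)
  have h1 := sq_norm_inner_le_of_symmetric A.domain.subtype A.toFun
    (fun x y => inner_apply_eq_of_isSelfAdjoint hA x y) hpos x ⟨y, hy⟩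
  have h2 := h1.trans (mul_nonpos_of_nonpos_of_nonneg h0 (hpos ⟨y, hy⟩))
  exact norm_eq_zero.1 (pow_eq_zero_iff two_ne_zero |>.1 (le_antisymm h2 (sq_nonneg _)))

omit [CompleteSpace H] in
lemma scale_mul_scale (hp : IsHomogeneous U p A) {s t : T} (hst : U s = (U t).symm) :
    p s * p t = 1 := by
  obtain ⟨x, hx⟩ := hp.ne_zero
  have h1 := hp.map_eq t x
  have h2 := hp.map_eq s ⟨U t x, (hp.mem_iff t x).1 x.2⟩
  have h3 : (⟨U s (U t x), (hp.mem_iff s _).1 ((hp.mem_iff t x).1 x.2)⟩ : A.domain) = x :=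
    Subtype.ext ((congrArg (fun V => V (U t x)) hst).trans ((U t).symm_apply_apply _))
  rw [h3] at h2
  have h4 : A x = ((p s * p t : ℝ) : ℂ) • A x := by
    conv_lhs => rw [← (U t).symm_apply_apply (A x), ← hst, h1, map_smul, h2, smul_smul]
    push_cast
    rw [mul_comm]
  have h5 : (1 - ((p s * p t : ℝ) : ℂ)) • A x = 0 := by rw [sub_smul, one_smul, ← h4, sub_self]
  have h6 := (smul_eq_zero.1 h5).resolve_right hx
  exact_mod_cast (sub_eq_zero.1 h6).symm

lemma map_resolvent (hp : IsHomogeneous U p A) (hA : IsSelfAdjoint A) (hpos : IsNonneg A) (t : T)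
    (x : H) : (p t : ℂ) • U t (resolvent A x) =
      resolvent A (U t x) + ((p t : ℂ) - 1) • resolvent A (U t (resolvent A x)) := by
  have hx := resolvent_mem hA hpos x
  have h1 := hp.map_eq t ⟨_, hx⟩
  rw [apply_resolvent hA hpos, map_sub] at h1
  have h2 := resolvent_shift hA hpos ⟨U t (resolvent A x), (hp.mem_iff t _).1 hx⟩
  rw [shift_apply] at h2
  dsimp only at h1 h2
  conv_lhs => rw [← h2]
  rw [← map_smul, smul_add, ← h1, map_add, map_sub, map_smul]
  module

lemma map_extResolvent (hp : IsHomogeneous U p A) (hA : IsSelfAdjoint A) (hpos : IsNonneg A)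
    {φ : HNegTwo A} {c : ℂ} {t : T} (hφ : extUnitary A (U t) φ = c • φ) :
    (p t : ℂ) • U t (extResolvent A φ) =
      c • extResolvent A φ + ((p t : ℂ) - 1) • resolvent A (U t (extResolvent A φ)) := by
  have h := extResolvent_extUnitary (U t) (p t) (fun x => by
    rw [hp.map_resolvent hA hpos t x]; push_cast; abel) φ
  rw [hφ, extResolvent_smul] at h
  rw [h]
  push_cast
  abel

lemma isScaling (hp : IsHomogeneous U p A) (hA : IsSelfAdjoint A) (hpos : IsNonneg A)
    (hψ : LinearIndependent ℂ ψ) {ξ : Fin n → T → ℝ}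
    (hξ : ∀ (j : Fin n) (t : T), extUnitary A (U t) (ψ j) = (ξ j t : ℂ) • ψ j) {s t : T}
    (hst : U s = (U t).symm) : (∀ j, ξ j s * ξ j t = 1) ∧
      IsScaling (resolvent A) (fun j => extResolvent A (ψ j)) (U t) (p t) (fun j => ξ j t) := by
  have hst' : (p s : ℂ) * p t = 1 := by exact_mod_cast hp.scale_mul_scale hst
  have hone : ∀ j, ξ j s * ξ j t = 1 := by
    intro j
    set h := extResolvent A (ψ j) with hh
    have h0 : h ≠ 0 := (linearIndependent_extResolvent A hψ).ne_zero j
    have e1 := hp.map_extResolvent hA hpos (hξ j t)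
    have e2 := hp.map_extResolvent hA hpos (hξ j s)
    have e3 := hp.map_resolvent hA hpos s (U t h)
    rw [← hh] at e1 e2
    have e4 : U s (U t h) = h := by rw [hst, (U t).symm_apply_apply]
    rw [e4] at e3
    have e5 := congrArg (U s) e1
    simp only [map_add, map_smul, e4] at e5
    have e6 := congrArg (resolvent A) e5
    simp only [map_add, map_smul] at e6
    set w := U s (resolvent A (U t h))
    have hKh : ((p s : ℂ) * p t) • resolvent A h = resolvent A h := by rw [hst', one_smul]
    -- Instead of composing the extended unitaries on `H₋₂`, the vectors `w` and `K w` are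
    -- eliminated between the eigenvector relation for `t` pulled back by `U s`, its image under
    -- `K`, and the resolvent relation for `s`.
    have e7 : ((ξ j s * ξ j t : ℝ) : ℂ) • h = ((p s : ℂ) * p t) • h := by
      push_cast
      have : ((ξ j s : ℂ) * ξ j t) • h = (ξ j t : ℂ) • ((p s : ℂ) • U s h -
          ((p s : ℂ) - 1) • resolvent A (U s h)) := by
        rw [e2]; module
      rw [this]
      linear_combination (norm := module) (- (p s : ℂ)) • e5 + ((p s : ℂ) - 1) • e6
        - ((p t : ℂ) - 1) • e3 - hKh
    rw [hst'] at e7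
    have e8 : (((ξ j s * ξ j t : ℝ) : ℂ) - 1) • h = 0 := by rw [sub_smul, e7, sub_self]
    exact_mod_cast sub_eq_zero.1 ((smul_eq_zero.1 e8).resolve_right h0)
  refine ⟨hone, hp.scale_pos hA hpos t, fun j => right_ne_zero_of_mul_eq_one (hone j),
    hp.map_resolvent hA hpos t, fun j => hp.map_extResolvent hA hpos (hξ j t), fun j => ?_⟩
  have e2 := hp.map_extResolvent hA hpos (hξ j s)
  rw [hst] at e2
  have hpt : (p t : ℂ) ≠ 0 := by exact_mod_cast hp.scale_ne_zero t
  have hps : (p s : ℂ) = (p t : ℂ)⁻¹ := eq_inv_of_mul_eq_one_left hst'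
  have hξs : (ξ j s : ℂ) = (ξ j t : ℂ)⁻¹ :=
    eq_inv_of_mul_eq_one_left (by exact_mod_cast hone j)
  rw [hps, hξs] at e2
  have e3 := congrArg (fun v => (p t : ℂ) • v) e2
  simp only [smul_add, smul_smul, mul_inv_cancel₀ hpt, one_smul, mul_sub, mul_one] at e3
  rw [div_eq_mul_inv]
  exact e3

end IsHomogeneous

/-- If the boundary matrix satisfies the scaling equations, the extension is homogeneous. -/
lemma mem_and_map_extensionOf (hA : IsSelfAdjoint A) (hpos : IsNonneg A)
    (hd : Dense ((symOp A ψ).domain : Set H)) {V : H ≃ₗᵢ[ℂ] H} {q : ℝ} {ξ : Fin n → ℝ}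
    (hs : IsScaling (resolvent A) (fun j => extResolvent A (ψ j)) V q ξ)
    (hR : ∀ i j, (ξ j - (q : ℂ) / ξ i) * R i j =
      (1 - (q : ℂ)) * ⟪extResolvent A (ψ i), V (extResolvent A (ψ j))⟫_ℂ)
    (f : (extensionOf A ψ R).domain) : ∃ hf : V f ∈ (extensionOf A ψ R).domain,
      V (extensionOf A ψ R f) = (q : ℂ) • extensionOf A ψ R ⟨V f, hf⟩ := by
  have hq : (q : ℂ) ≠ 0 := by exact_mod_cast hs.pos.ne'
  have hK := isFirmlyNonexpansive_resolvent hA hpos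
  obtain ⟨y, α, hy, hf⟩ := (mem_extensionOf hA hpos).1 f.2
  have h1 := hs.map_add_sum hf
  have hV : V f ∈ (extensionOf A ψ R).domain := by
    refine (mem_extensionOf hA hpos).2 ⟨_, _, fun i => ?_, h1⟩
    have h2 := hs.inner_add_mulVec hK R hf i
    simp only [hy, hR, sub_self, mul_zero, Finset.sum_const_zero, add_zero] at h2
    exact (mul_eq_zero.1 h2).resolve_left hq
  refine ⟨hV, ?_⟩
  rw [extensionOf_apply hA hpos hd f hf, extensionOf_apply hA hpos hd ⟨V f, hV⟩ h1, smul_sub,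
    smul_smul, mul_inv_cancel₀ hq, map_sub]
  module

lemma scaling_eq_of_map_extensionOf (hA : IsSelfAdjoint A) (hpos : IsNonneg A)
    (hd : Dense ((symOp A ψ).domain : Set H)) (hψ : LinearIndependent ℂ ψ) {V : H ≃ₗᵢ[ℂ] H}
    {q : ℝ} {ξ : Fin n → ℝ}
    (hs : IsScaling (resolvent A) (fun j => extResolvent A (ψ j)) V q ξ)
    (hN : ∀ f : (extensionOf A ψ R).domain, ∃ hf : V f ∈ (extensionOf A ψ R).domain,
      V (extensionOf A ψ R f) = (q : ℂ) • extensionOf A ψ R ⟨V f, hf⟩) (i j : Fin n) :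
    (ξ j - (q : ℂ) / ξ i) * R i j =
      (1 - (q : ℂ)) * ⟪extResolvent A (ψ i), V (extResolvent A (ψ j))⟫_ℂ := by
  have hq : (q : ℂ) ≠ 0 := by exact_mod_cast hs.pos.ne'
  have hK := isFirmlyNonexpansive_resolvent hA hpos
  have hh := linearIndependent_extResolvent A hψ
  obtain ⟨y, hy⟩ := exists_inner_eq hh (-(R.mulVec (Pi.single j 1)))
  set f := resolvent A y + ∑ p, (Pi.single j 1 : Fin n → ℂ) p • extResolvent A (ψ p) with hfdef
  have hf : f ∈ (extensionOf A ψ R).domain :=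
    (mem_extensionOf hA hpos).2 ⟨y, Pi.single j 1, fun k => by rw [hy]; simp, rfl⟩
  obtain ⟨hVf, hv⟩ := hN ⟨f, hf⟩
  obtain ⟨y', α', hy', hf'⟩ := (mem_extensionOf hA hpos).1 hVf
  rw [extensionOf_apply hA hpos hd ⟨f, hf⟩ hfdef, extensionOf_apply hA hpos hd ⟨_, hVf⟩ hf'] at hv
  have h1 := hs.map_add_sum hfdef
  -- The value of the operator at `V f` determines `y'`; independence of the `h_p` then determines
  -- `α'`.
  have hyy : y' = (q : ℂ)⁻¹ • (V y + ((q : ℂ) - 1) • V f) := by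
    rw [eq_inv_smul_iff₀ hq]
    simp only [map_sub] at hv
    linear_combination (norm := module) -hv
  have hαα : α' = fun k => (q : ℂ)⁻¹ * (ξ k * (Pi.single j 1 : Fin n → ℂ) k) := by
    have h2 := hf'.symm.trans h1
    rw [hyy] at h2
    exact hh.fintypeLinearCombination_injective (add_left_cancel h2)
  have h3 := hs.inner_add_mulVec hK R hfdef i
  rw [← hyy, ← hαα, hy', hy] at h3
  simp only [Pi.neg_apply, neg_add_cancel, mul_zero, zero_add, Pi.single_apply, ite_mul, one_mul,
    zero_mul, Finset.sum_ite_eq', Finset.mem_univ, if_true] at h3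
  exact (sub_eq_zero.1 h3.symm)

/-- If the extension vanished, so would `A_sym`, and `(A x, z) = (x, A_sym z) = 0` on a dense set of
`z` would give `A = 0`. -/
lemma exists_extensionOf_ne_zero (hA : IsSelfAdjoint A) (hpos : IsNonneg A)
    (hd : Dense ((symOp A ψ).domain : Set H)) (h0 : ∃ x : A.domain, A x ≠ 0) :
    ∃ x : (extensionOf A ψ R).domain, extensionOf A ψ R x ≠ 0 := by
  by_contra! h
  obtain ⟨x, hx⟩ := h0
  apply hx
  have h1 : x = ⟨resolvent A (shift A x), resolvent_mem hA hpos _⟩ :=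
    Subtype.ext (resolvent_shift hA hpos x).symm
  rw [h1, apply_resolvent hA hpos]
  refine hd.eq_zero_of_inner_left ℂ fun z hz => ?_
  have h2 := inner_eq_inner_symOp hA hpos (shift A x) 0 ⟨z, hz⟩
  have hle := symOp_le_extensionOf (R := R) hA hpos hd
  rw [hle.2 (y := ⟨z, hle.1 hz⟩) rfl, h, inner_zero_right] at h2
  simpa [inner_sub_left] using h2

end SingularPerturbation

/-! ### The limit of the Weyl form at `m → 1` -/

namespace SingularPerturbation

/-- A monotone function on `(-∞, 1)` which is homogeneous with respect to the distance to `1` and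
unbounded below tends to zero at `1`. -/
lemma tendsto_zero_of_homogeneous {φ : ℝ → ℝ} (hφ : ∀ m m', m ≤ m' → m' < 1 → φ m ≤ φ m')
    {q κ : ℝ} (hq : 1 < q) (hκ0 : 0 < κ) (hκ1 : κ ≠ 1)
    (hs : ∀ m m', m < 1 → q * (1 - m') = 1 - m → φ m' = κ * φ m)
    (hb : ∀ C, ∃ m < 1, φ m < C) : Tendsto φ (𝓝[<] 1) (𝓝 0) := by
  have hq0 : 0 < q := by linarith
  rcases lt_or_gt_of_ne hκ1 with hκ | hκ
  -- For `κ < 1` the values along a sequence increasing to `1` decay geometrically, and monotonicity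
  -- fills the gaps.
  · have h1 : ∀ k : ℕ, φ (1 - q⁻¹ ^ k) = κ ^ k * φ 0 := by
      intro k
      induction k with
      | zero => simp
      | succ k ih =>
        rw [hs (1 - q⁻¹ ^ k) (1 - q⁻¹ ^ (k + 1)) (by linarith [pow_pos (inv_pos.2 hq0) k])
          (by rw [pow_succ]; field_simp; ring), ih]
        ring
    have hpow : Tendsto (fun k : ℕ => q⁻¹ ^ k) atTop (𝓝 0) :=
      tendsto_pow_atTop_nhds_zero_of_lt_one (inv_pos.2 hq0).le (inv_lt_one_of_one_lt₀ hq)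
    have h2 : Tendsto (fun k : ℕ => φ (1 - q⁻¹ ^ k)) atTop (𝓝 0) := by
      simp only [h1]
      simpa using (tendsto_pow_atTop_nhds_zero_of_lt_one hκ0.le hκ).mul_const (φ 0)
    have h3 : ∀ m < 1, φ m ≤ 0 := by
      intro m hm
      refine ge_of_tendsto h2 ?_
      filter_upwards [hpow.eventually (gt_mem_nhds (sub_pos.2 hm))] with k hk
      exact hφ _ _ (by linarith) (by linarith [pow_pos (inv_pos.2 hq0) k])
    rw [Metric.tendsto_nhds]
    intro ε hε
    obtain ⟨k, hk⟩ := (h2.eventually (lt_mem_nhds (neg_lt_zero.2 hε))).exists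
    have hk1 : 1 - q⁻¹ ^ k < 1 := by linarith [pow_pos (inv_pos.2 hq0) k]
    filter_upwards [Ioo_mem_nhdsLT hk1] with m hm
    rw [Real.dist_eq, sub_zero, abs_lt]
    exact ⟨hk.trans_le (hφ _ _ hm.1.le hm.2), (h3 m hm.2).trans_lt hε⟩
  -- For `κ > 1` the values along `1 - q ^ k → -∞` are `κ ^ (-k) φ 0`, so `φ` would be bounded
  -- below.
  · exfalso
    have h1 : ∀ k : ℕ, κ ^ k * φ (1 - q ^ k) = φ 0 := by
      intro k
      induction k with
      | zero => simp
      | succ k ih =>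
        rw [← ih, hs (1 - q ^ (k + 1)) (1 - q ^ k) (by linarith [pow_pos hq0 (k + 1)])
          (by rw [pow_succ]; ring)]
        ring
    obtain ⟨m, hm, hm'⟩ := hb (-|φ 0|)
    obtain ⟨k, hk⟩ := pow_unbounded_of_one_lt (1 - m) hq
    have h2 := hφ (1 - q ^ k) m (by linarith) hm
    have h3 := h1 k
    have h4 : 1 ≤ κ ^ k := one_le_pow₀ hκ.le
    have h5 := neg_abs_le (φ 0)
    nlinarith [abs_nonneg (φ 0)]

variable {H : Type*} [NormedAddCommGroup H] [InnerProductSpace ℂ H] [CompleteSpace H]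

/-- After division by `m - m'` this is `0 ≤ ‖z‖² - 2 m (K z, z) + m m' ‖K z‖²`, where the sign of
`m` is essential. The left side is a squared `H₋₁` norm, the right side a telescoping increment. -/
lemma IsFirmlyNonexpansive.inner_smul_neumann_sub_le {K : H →L[ℂ] H}
    (hK : IsFirmlyNonexpansive K) {m m' : ℝ} (h : m' ≤ m) (hm : m ≤ 0) (x : H) :
    (⟪K ((m : ℂ) • neumann K m x - (m' : ℂ) • neumann K m' x),
      (m : ℂ) • neumann K m x - (m' : ℂ) • neumann K m' x⟫_ℂ).re ≤
      (weylForm K m x x).re - (weylForm K m' x x).re := by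
  have hm1 : m < 1 := by linarith
  have hm1' : m' < 1 := by linarith
  rw [← Complex.sub_re, hK.weylForm_sub hm1' hm1, hK.neumann_resolvent hm1' hm1]
  set z := neumann K m (neumann K m' x) with hz
  have h1 : neumann K m' x = z - (m : ℂ) • K z := (hK.neumann_sub hm1 _).symm
  have h2 : x = (z - (m : ℂ) • K z) - (m' : ℂ) • K (z - (m : ℂ) • K z) := by
    rw [← h1, hK.neumann_sub hm1']
  have e2 : (⟪x, z⟫_ℂ).re =
      ‖z‖ ^ 2 - (m + m') * (⟪K z, z⟫_ℂ).re + m * m' * ‖K z‖ ^ 2 := by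
    rw [re_inner_comm]
    conv_lhs => rw [h2]
    rw [← re_inner_self, ← re_inner_self]
    simp only [map_sub, map_smul, inner_sub_right, inner_smul_right, ← hK.symm, Complex.sub_re,
      Complex.re_ofReal_mul]
    rw [hK.symm (K z) z]
    ring
  rw [map_smul, inner_smul_left, inner_smul_right, Complex.conj_ofReal, Complex.re_ofReal_mul,
    Complex.re_ofReal_mul, Complex.re_ofReal_mul, e2]
  refine mul_le_mul_of_nonneg_left ?_ (sub_nonneg.2 h)
  nlinarith [mul_nonneg (neg_nonneg.2 hm) (hK.nonneg z), sq_nonneg ‖z‖,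
    mul_nonneg (mul_nonneg_of_nonpos_of_nonpos hm (h.trans hm)) (sq_nonneg ‖K z‖)]

variable {A : H →ₗ.[ℂ] H} {n : ℕ}

/-- If the Weyl form of `h = (A + I)⁻¹ ψ` is bounded below, then `ψ` belongs to `H₋₁(A)`. -/
lemma memHNegOne_of_weylForm_bounded (hA : IsSelfAdjoint A) (hpos : IsNonneg A) {φ : HNegTwo A}
    {C : ℝ} (hC : ∀ m < 1, C ≤ (weylForm (resolvent A) m (extResolvent A φ)
      (extResolvent A φ)).re) : MemHNegOne A φ := by
  have hK := isFirmlyNonexpansive_resolvent hA hpos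
  set K := resolvent A
  set h := extResolvent A φ
  have hneg : ∀ k : ℕ, (-(k : ℝ)) ≤ 0 := fun k => by simp
  -- Approximants of `φ` by vectors of `H`: `K (y k) = h - (1 + k K)⁻¹ h` tends to `h`, and
  -- boundedness of the Weyl form makes them Cauchy in `H₋₁`.
  let y : ℕ → H := fun k => (k : ℂ) • neumann K (-(k : ℝ)) h
  let a : ℕ → ℝ := fun k => -(weylForm K (-(k : ℝ)) h h).re
  have ha : Monotone a := fun k l hkl => neg_le_neg
    (hK.weylForm_self_mono (by simpa using hkl) (by linarith [hneg k]) h)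
  have haC : ∀ k, a k ≤ -C := fun k => neg_le_neg (hC _ (by linarith [hneg k]))
  have hac : CauchySeq a := (tendsto_atTop_ciSup ha
    ⟨-C, by rintro _ ⟨k, rfl⟩; exact haC k⟩).cauchySeq
  have hya : ∀ k l, k ≤ l → ‖sqrtResolvent A (y l) - sqrtResolvent A (y k)‖ ^ 2 ≤ a l - a k := by
    intro k l hkl
    rw [← map_sub, sq_norm_sqrtResolvent hA hpos]
    have h1 := hK.inner_smul_neumann_sub_le (m := -(k : ℝ)) (m' := -(l : ℝ)) (by simpa using hkl)
      (hneg k) h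
    have h2 : y l - y k = ((-(k : ℝ) : ℝ) : ℂ) • neumann K (-(k : ℝ)) h -
        ((-(l : ℝ) : ℝ) : ℂ) • neumann K (-(l : ℝ)) h := by
      simp only [y]
      push_cast
      module
    rw [h2]
    refine h1.trans (le_of_eq ?_)
    simp only [a]
    ring
  refine memHNegOne_of_cauchySeq hA hpos (y := y) ?_ ?_
  · rw [Metric.cauchySeq_iff'] at hac ⊢
    intro ε hε
    obtain ⟨N, hN⟩ := hac (ε ^ 2) (by positivity)
    refine ⟨N, fun k hk => ?_⟩
    have h1 := hN k hk
    rw [Real.dist_eq] at h1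
    rw [dist_eq_norm]
    exact lt_of_pow_lt_pow_left₀ 2 hε.le ((hya N k hk).trans_lt ((le_abs_self _).trans_lt h1))
  · have h1 : ∀ k, K (y k) = h - neumann K (-(k : ℝ)) h := by
      intro k
      have := hK.neumann_sub (m := -(k : ℝ)) (by linarith [hneg k]) h
      simp only [y, map_smul]
      push_cast at this
      linear_combination (norm := module) this
    have h2 : Tendsto (fun k : ℕ => neumann K (-(k : ℝ)) h) atTop (𝓝 0) := by
      rw [tendsto_zero_iff_norm_tendsto_zero]
      have h3 : Tendsto (fun k : ℕ => ‖neumann K (-(k : ℝ)) h‖ ^ 2) atTop (𝓝 0) := by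
        refine squeeze_zero' (Eventually.of_forall fun k => sq_nonneg _) ?_
          (tendsto_const_div_atTop_nhds_zero_nat (-C))
        filter_upwards [eventually_gt_atTop 0] with k hk
        have hk' : (0 : ℝ) < k := by exact_mod_cast hk
        rw [le_div_iff₀ hk']
        have h4 := hK.sq_norm_neumann_le (hneg k) h
        have h5 := haC k
        simp only [a, weylForm, Complex.re_ofReal_mul] at h5
        nlinarith
      have h4 := h3.sqrt
      simpa using h4
    refine Tendsto.congr (fun k => (h1 k).symm) ?_
    simpa using h2.const_sub h

/-- For each pair of indices `i`, `j` there is a scaling of the resolvent which is nondegenerate for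
that pair and for which `R` solves the scaling equations. -/
def HasScalings (K : H →L[ℂ] H) (h : Fin n → H) (R : Matrix (Fin n) (Fin n) ℂ) : Prop :=
  ∀ i j, ∃ (V : H ≃ₗᵢ[ℂ] H) (q : ℝ) (ξ : Fin n → ℝ), IsScaling K h V q ξ ∧ 1 ≤ q ∧
    ξ i * ξ j ≠ q ∧ ∀ i j, (ξ j - (q : ℂ) / ξ i) * R i j = (1 - (q : ℂ)) * ⟪h i, V (h j)⟫_ℂ

lemma IsScaling.weylForm_add_eq {K : H →L[ℂ] H} {h : Fin n → H} {V : H ≃ₗᵢ[ℂ] H} {q : ℝ}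
    {ξ : Fin n → ℝ} (hs : IsScaling K h V q ξ) (hK : IsFirmlyNonexpansive K)
    {R : Matrix (Fin n) (Fin n) ℂ} {i j : Fin n}
    (hR : (ξ j - (q : ℂ) / ξ i) * R i j = (1 - (q : ℂ)) * ⟪h i, V (h j)⟫_ℂ) {m m' : ℝ}
    (hm : m < 1) (hmm : q * (1 - m') = 1 - m) :
    weylForm K m' (h i) (h j) + R i j =
      ((q / (ξ i * ξ j) : ℝ) : ℂ) * (weylForm K m (h i) (h j) + R i j) := by
  have hi : (ξ i : ℂ) ≠ 0 := by exact_mod_cast hs.ne_zero i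
  have hj : (ξ j : ℂ) ≠ 0 := by exact_mod_cast hs.ne_zero j
  rw [hs.weylForm_eq hK hm hmm, div_mul_eq_mul_div (1 - (q : ℂ)), ← hR]
  push_cast
  field_simp
  ring

variable {ψ : Fin n → HNegTwo A} {R : Matrix (Fin n) (Fin n) ℂ}

lemma tendsto_weylForm_add_re (hA : IsSelfAdjoint A) (hpos : IsNonneg A)
    (hψ : LinearIndependent ℂ ψ) (hψ1 : ∀ i, ¬ MemHNegOne A (ψ i))
    (hS : HasScalings (resolvent A) (fun j => extResolvent A (ψ j)) R) (i : Fin n) :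
    Tendsto (fun m => (weylForm (resolvent A) m (extResolvent A (ψ i))
      (extResolvent A (ψ i))).re + (R i i).re) (𝓝[<] 1) (𝓝 0) := by
  have hK := isFirmlyNonexpansive_resolvent hA hpos
  obtain ⟨V, q, ξ, hs, hq, hne, hR⟩ := hS i i
  have h0 := (linearIndependent_extResolvent A hψ).ne_zero i
  -- On the diagonal `q = 1` is impossible: it would give `V h_i = ξ_i h_i`, so `ξ_i² = 1 = q`.
  have hq1 : 1 < q := lt_of_le_of_ne hq fun h => hne (by
    rw [← sq, hs.sq_eq_one h.symm i h0, h])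
  have hξ : 0 < ξ i * ξ i := mul_self_pos.2 (hs.ne_zero i)
  refine tendsto_zero_of_homogeneous (q := q) (κ := q / (ξ i * ξ i))
    (fun m m' hm hm' => add_le_add_left (hK.weylForm_self_mono hm hm' _) _) hq1
    (div_pos hs.pos hξ) (fun h => hne ((div_eq_one_iff_eq hξ.ne').1 h).symm) ?_ ?_
  · intro m m' hm hmm
    have := congrArg Complex.re (hs.weylForm_add_eq hK (hR i i) hm hmm)
    rwa [Complex.re_ofReal_mul, Complex.add_re, Complex.add_re] at this
  · by_contra! hc
    obtain ⟨C, hC⟩ := hc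
    exact hψ1 i (memHNegOne_of_weylForm_bounded hA hpos (C := C - (R i i).re) fun m hm => by
      linarith [hC m hm])

lemma tendsto_weylForm_add (hA : IsSelfAdjoint A) (hpos : IsNonneg A)
    (hψ : LinearIndependent ℂ ψ) (hψ1 : ∀ i, ¬ MemHNegOne A (ψ i))
    (hS : HasScalings (resolvent A) (fun j => extResolvent A (ψ j)) R) (i j : Fin n) :
    Tendsto (fun m => weylForm (resolvent A) m (extResolvent A (ψ i))
      (extResolvent A (ψ j)) + R i j) (𝓝[<] 1) (𝓝 0) := by
  have hK := isFirmlyNonexpansive_resolvent hA hpos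
  have hd := tendsto_weylForm_add_re hA hpos hψ hψ1 hS
  obtain ⟨V, q, ξ, hs, hq, hne, hR⟩ := hS i j
  set h := fun j => extResolvent A (ψ j) with hh
  have hq0 := hs.pos
  have hξ : ξ i * ξ j ≠ 0 := mul_ne_zero (hs.ne_zero i) (hs.ne_zero j)
  set κ : ℝ := q / (ξ i * ξ j)
  have hκ : κ - 1 ≠ 0 := sub_ne_zero.2 fun h => hne ((div_eq_one_iff_eq hξ).1 h).symm
  -- The map `λ ↦ λ / q` in the variable `m`. Homogeneity writes `(κ - 1) (M + R)_ij` as an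
  -- increment of `M_ij` from `m` to `σ m`, and the diagonal increments tend to `0`. The case `q =
  -- 1`, `σ = id` is allowed here.
  let σ : ℝ → ℝ := fun m => 1 - (1 - m) / q
  have hσ : ∀ m, q * (1 - σ m) = 1 - m := fun m => by simp only [σ]; field_simp; ring
  have hσ1 : ∀ m < 1, σ m < 1 := fun m hm => by
    simp only [σ]; linarith [div_pos (sub_pos.2 hm) hq0]
  have hσm : ∀ m < 1, m ≤ σ m := fun m hm => by
    simp only [σ]; linarith [div_le_self (sub_pos.2 hm).le hq]
  have hσt : Tendsto σ (𝓝[<] 1) (𝓝[<] 1) := by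
    refine tendsto_nhdsWithin_iff.2 ⟨?_, ?_⟩
    · have : Continuous σ := by fun_prop
      have h1 := (this.tendsto 1).mono_left (nhdsWithin_le_nhds (s := Set.Iio 1))
      simpa [σ] using h1
    · filter_upwards [self_mem_nhdsWithin] with m hm using hσ1 m hm
  have hdiff : ∀ i, Tendsto (fun m => (weylForm (resolvent A) (σ m) (h i) (h i)).re -
      (weylForm (resolvent A) m (h i) (h i)).re) (𝓝[<] 1) (𝓝 0) := by
    intro i
    have h1 := ((hd i).comp hσt).sub (hd i)
    rw [sub_self] at h1
    refine h1.congr fun m => ?_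
    simp only [Function.comp_apply, hh]
    ring
  have h2 := (hdiff i).mul (hdiff j)
  rw [mul_zero] at h2
  rw [tendsto_zero_iff_norm_tendsto_zero]
  have h3 : Tendsto (fun m => (κ - 1) ^ 2 *
      ‖weylForm (resolvent A) m (h i) (h j) + R i j‖ ^ 2) (𝓝[<] 1) (𝓝 0) := by
    refine squeeze_zero' (Eventually.of_forall fun m => by positivity) ?_ h2
    filter_upwards [self_mem_nhdsWithin] with m hm
    refine le_trans (le_of_eq ?_) (hK.sq_norm_weylForm_sub_le (hσm m hm) (hσ1 m hm) (h i) (h j))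
    have h4 := hs.weylForm_add_eq hK (hR i j) hm (hσ m)
    have h5 : weylForm (resolvent A) (σ m) (h i) (h j) - weylForm (resolvent A) m (h i) (h j) =
        ((κ - 1 : ℝ) : ℂ) * (weylForm (resolvent A) m (h i) (h j) + R i j) := by
      push_cast
      linear_combination h4
    rw [h5, norm_mul, mul_pow, Complex.norm_real, Real.norm_eq_abs, sq_abs]
  have h6 := (h3.const_mul ((κ - 1) ^ 2)⁻¹).sqrt
  simp only [inv_mul_cancel_left₀ (pow_ne_zero 2 hκ), mul_zero, Real.sqrt_zero] at h6
  refine h6.congr fun m => Real.sqrt_sq (norm_nonneg _)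

omit [CompleteSpace H] in
lemma weylForm_sum (K : H →L[ℂ] H) (h : Fin n → H) (c : Fin n → ℂ) (m : ℝ) :
    weylForm K m (∑ p, c p • h p) (∑ p, c p • h p) =
      ∑ i, conj (c i) * ∑ j, weylForm K m (h i) (h j) * c j := by
  simp only [weylForm, map_sum, map_smul, inner_sum, sum_inner, inner_smul_left, inner_smul_right,
    Finset.mul_sum]
  rw [Finset.sum_comm]
  exact Finset.sum_congr rfl fun i _ => Finset.sum_congr rfl fun j _ => by ring

/-- A nondecreasing function of `m` with limit `0` at `1` is nonpositive. -/
lemma weylForm_add_nonpos (hA : IsSelfAdjoint A) (hpos : IsNonneg A)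
    (hψ : LinearIndependent ℂ ψ) (hψ1 : ∀ i, ¬ MemHNegOne A (ψ i))
    (hS : HasScalings (resolvent A) (fun j => extResolvent A (ψ j)) R) (c : Fin n → ℂ) {m : ℝ}
    (hm : m < 1) :
    (weylForm (resolvent A) m (∑ p, c p • extResolvent A (ψ p))
      (∑ p, c p • extResolvent A (ψ p)) + ∑ i, conj (c i) * R.mulVec c i).re ≤ 0 := by
  have hK := isFirmlyNonexpansive_resolvent hA hpos
  have h1 : Tendsto (fun m => (weylForm (resolvent A) m (∑ p, c p • extResolvent A (ψ p))
      (∑ p, c p • extResolvent A (ψ p)) + ∑ i, conj (c i) * R.mulVec c i).re) (𝓝[<] 1) (𝓝 0) := by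
    have h2 : Tendsto (fun m => ∑ i, conj (c i) * ∑ j, (weylForm (resolvent A) m
        (extResolvent A (ψ i)) (extResolvent A (ψ j)) + R i j) * c j) (𝓝[<] 1)
        (𝓝 (∑ i : Fin n, conj (c i) * ∑ j : Fin n, 0 * c j)) :=
      tendsto_finsetSum _ fun i _ => (tendsto_finsetSum _ fun j _ =>
        (tendsto_weylForm_add hA hpos hψ hψ1 hS i j).mul_const _).const_mul _
    simp only [zero_mul, Finset.sum_const_zero, mul_zero] at h2
    have h3 := (Complex.continuous_re.tendsto _).comp h2
    refine h3.congr fun m => congrArg Complex.re ?_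
    rw [weylForm_sum, ← Finset.sum_add_distrib]
    refine Finset.sum_congr rfl fun i _ => ?_
    simp only [Matrix.mulVec, dotProduct, add_mul, Finset.sum_add_distrib, mul_add]
  refine ge_of_tendsto h1 ?_
  filter_upwards [Ioo_mem_nhdsLT hm] with m' hm'
  rw [Complex.add_re, Complex.add_re]
  exact add_le_add_left (hK.weylForm_self_mono hm'.1.le hm'.2 _) _

end SingularPerturbation

/-! ### Nonnegativity and minimality of the extension -/

namespace SingularPerturbation

variable {H : Type*} [NormedAddCommGroup H] [InnerProductSpace ℂ H] [CompleteSpace H]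
variable {A : H →ₗ.[ℂ] H} {n : ℕ} {ψ : Fin n → HNegTwo A} {R : Matrix (Fin n) (Fin n) ℂ}

/-- The form of an extension, in the decomposition `f = K z + (1 - m K)⁻¹ a`. -/
lemma IsFirmlyNonexpansive.re_inner_sub_eq {K : H →L[ℂ] H} (hK : IsFirmlyNonexpansive K) {m : ℝ}
    (hm : m < 1) {f y a z : H} (hf : f = K y + a) (hz : z = y - (m : ℂ) • neumann K m a) :
    (⟪y - f, f⟫_ℂ).re + (1 - m) * ‖f‖ ^ 2 =
      (⟪z - K z, K z⟫_ℂ).re + (1 - m) * ‖K z‖ ^ 2 + (⟪z, a⟫_ℂ).re := by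
  set e := neumann K m a with he
  have ha : a = e - (m : ℂ) • K e := (hK.neumann_sub hm a).symm
  have hfz : f = K z + e := by
    rw [hf, hz, map_sub, map_smul]
    conv_lhs => rw [ha]
    abel
  have h1 : y - (m : ℂ) • f = z - (m : ℂ) • K z := by
    rw [hfz, hz]; module
  have h2 : (⟪y - f, f⟫_ℂ).re + (1 - m) * ‖f‖ ^ 2 = (⟪y - (m : ℂ) • f, f⟫_ℂ).re := by
    rw [inner_sub_left, inner_sub_left, inner_smul_left, Complex.conj_ofReal, Complex.sub_re,
      Complex.sub_re, Complex.re_ofReal_mul, re_inner_self]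
    ring
  have h3 : (⟪z - K z, K z⟫_ℂ).re + (1 - m) * ‖K z‖ ^ 2 =
      (⟪z - (m : ℂ) • K z, K z⟫_ℂ).re := by
    rw [inner_sub_left, inner_sub_left, inner_smul_left, Complex.conj_ofReal, Complex.sub_re,
      Complex.sub_re, Complex.re_ofReal_mul, re_inner_self]
    ring
  have h4 : ⟪z - (m : ℂ) • K z, e⟫_ℂ = ⟪z, a⟫_ℂ := by
    rw [ha, inner_sub_left, inner_sub_right, inner_smul_left, inner_smul_right, hK.symm,
      Complex.conj_ofReal]
  rw [h2, h3, h1, hfz, inner_add_right, Complex.add_re, h4]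

omit [CompleteSpace H] in
lemma IsFirmlyNonexpansive.re_inner_sub_nonneg {K : H →L[ℂ] H} (hK : IsFirmlyNonexpansive K)
    (z : H) : 0 ≤ (⟪z - K z, K z⟫_ℂ).re := by
  rw [inner_sub_left, Complex.sub_re, re_inner_self, re_inner_comm]
  linarith [hK.sq_le z]

omit [CompleteSpace H] in
-- These pairings are the obstruction to `K z` lying in the domain of `A_sym`; they vanish in the
-- limit `m → 1` because `M(m) + R → 0`.
lemma inner_sub_neumann (K : H →L[ℂ] H) (h : Fin n → H) (m : ℝ) {y : H} {α : Fin n → ℂ}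
    (hy : ∀ i, ⟪h i, y⟫_ℂ + R.mulVec α i = 0) (i : Fin n) :
    ⟪h i, y - (m : ℂ) • neumann K m (∑ p, α p • h p)⟫_ℂ =
      -∑ p, (weylForm K m (h i) (h p) + R i p) * α p := by
  rw [inner_sub_right, inner_smul_right, eq_neg_of_add_eq_zero_left (hy i)]
  simp only [map_sum, map_smul, inner_sum, inner_smul_right, weylForm, add_mul,
    Finset.sum_add_distrib, Matrix.mulVec, dotProduct, Finset.mul_sum]
  rw [neg_add_rev, sub_eq_add_neg]
  congr 2
  exact Finset.sum_congr rfl fun p _ => by ring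

lemma re_inner_sub_neumann_nonneg (hA : IsSelfAdjoint A) (hpos : IsNonneg A)
    (hψ : LinearIndependent ℂ ψ) (hψ1 : ∀ i, ¬ MemHNegOne A (ψ i))
    (hS : HasScalings (resolvent A) (fun j => extResolvent A (ψ j)) R) {y : H} {α : Fin n → ℂ}
    (hy : ∀ i, ⟪extResolvent A (ψ i), y⟫_ℂ + R.mulVec α i = 0) {m : ℝ} (hm : m < 1) :
    0 ≤ (⟪y - (m : ℂ) • neumann (resolvent A) m (∑ p, α p • extResolvent A (ψ p)),
      ∑ p, α p • extResolvent A (ψ p)⟫_ℂ).re := by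
  have h1 := weylForm_add_nonpos hA hpos hψ hψ1 hS α hm
  rw [re_inner_comm, inner_sub_right, inner_smul_right, inner_sum_smul]
  simp only [fun i => eq_neg_of_add_eq_zero_left (hy i), mul_neg, Finset.sum_neg_distrib]
  rw [← neg_nonneg, ← Complex.neg_re, weylForm] at h1
  convert h1 using 2
  ring

lemma isNonneg_extensionOf (hA : IsSelfAdjoint A) (hpos : IsNonneg A)
    (hd : Dense ((symOp A ψ).domain : Set H))
    (hψ : LinearIndependent ℂ ψ) (hψ1 : ∀ i, ¬ MemHNegOne A (ψ i))
    (hS : HasScalings (resolvent A) (fun j => extResolvent A (ψ j)) R) :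
    IsNonneg (extensionOf A ψ R) := by
  intro f
  have hK := isFirmlyNonexpansive_resolvent hA hpos
  obtain ⟨y, α, hy, hf⟩ := (mem_extensionOf hA hpos).1 f.2
  rw [extensionOf_apply hA hpos hd f hf]
  have h1 : Tendsto (fun m : ℝ => (⟪y - (f : H), f⟫_ℂ).re + (1 - m) * ‖(f : H)‖ ^ 2) (𝓝[<] 1)
      (𝓝 ((⟪y - (f : H), f⟫_ℂ).re + (1 - 1) * ‖(f : H)‖ ^ 2)) :=
    (Continuous.tendsto (by fun_prop) 1).mono_left nhdsWithin_le_nhds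
  rw [sub_self, zero_mul, add_zero] at h1
  refine ge_of_tendsto h1 ?_
  filter_upwards [self_mem_nhdsWithin] with m (hm : m < 1)
  rw [hK.re_inner_sub_eq hm hf rfl]
  exact add_nonneg (add_nonneg (hK.re_inner_sub_nonneg _)
    (mul_nonneg (by linarith) (sq_nonneg _))) (re_inner_sub_neumann_nonneg hA hpos hψ hψ1 hS hy hm)

/-- The squared norm is at most `(1 - m) / m` times the diagonal Weyl form, which stays bounded near
`1` because it converges. -/
lemma tendsto_smul_neumann (hA : IsSelfAdjoint A) (hpos : IsNonneg A)
    (hψ : LinearIndependent ℂ ψ) (hψ1 : ∀ i, ¬ MemHNegOne A (ψ i))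
    (hS : HasScalings (resolvent A) (fun j => extResolvent A (ψ j)) R) (i : Fin n) :
    Tendsto (fun m : ℝ => ((1 - m : ℝ) : ℂ) • neumann (resolvent A) m (extResolvent A (ψ i)))
      (𝓝[<] 1) (𝓝 0) := by
  have hK := isFirmlyNonexpansive_resolvent hA hpos
  set h := extResolvent A (ψ i)
  have h1 := (tendsto_weylForm_add_re hA hpos hψ hψ1 hS i).sub_const (R i i).re
  simp only [add_sub_cancel_right] at h1
  have h2 : Tendsto (fun m : ℝ => (1 - m) / m) (𝓝[<] 1) (𝓝 ((1 - 1) / 1)) :=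
    (ContinuousAt.tendsto (by fun_prop (disch := norm_num))).mono_left nhdsWithin_le_nhds
  have h3 := h2.mul h1
  rw [sub_self, zero_div, zero_mul] at h3
  rw [tendsto_zero_iff_norm_tendsto_zero]
  have h4 : Tendsto (fun m : ℝ => ‖((1 - m : ℝ) : ℂ) • neumann (resolvent A) m h‖ ^ 2) (𝓝[<] 1)
      (𝓝 0) := by
    refine squeeze_zero' (Eventually.of_forall fun m => sq_nonneg _) ?_ h3
    filter_upwards [Ioo_mem_nhdsLT (zero_lt_one (α := ℝ))] with m hm
    have h5 := hK.one_sub_mul_sq_norm_neumann_le hm.1.le hm.2 h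
    have hm0 : m ≠ 0 := hm.1.ne'
    rw [norm_smul, mul_pow, Complex.norm_real, Real.norm_eq_abs, sq_abs, weylForm,
      Complex.re_ofReal_mul, div_mul_eq_mul_div, mul_left_comm, mul_div_cancel_left₀ _ hm0, sq,
      mul_assoc]
    exact mul_le_mul_of_nonneg_left h5 (by linarith [hm.2])
  simpa using h4.sqrt

/-- On `D(A_sym)` the inequality is Cauchy–Schwarz for `B`. It passes to `f` through vectors `K z_m
∈ D(A_sym)` whose images under `A_sym` tend to `y - f` and whose forms have upper limit at most `(y
- f, f)`; convergence of `K z_m` to `f` is not needed. -/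
lemma sq_norm_inner_extensionOf_le (hA : IsSelfAdjoint A) (hpos : IsNonneg A)
    (hψ : LinearIndependent ℂ ψ) (hψ1 : ∀ i, ¬ MemHNegOne A (ψ i))
    (hS : HasScalings (resolvent A) (fun j => extResolvent A (ψ j)) R)
    {B : H →ₗ.[ℂ] H} (hB : symOp A ψ ≤ B) (hBs : IsSelfAdjoint B) (hBn : IsNonneg B)
    {f y : H} {α : Fin n → ℂ} (hy : ∀ i, ⟪extResolvent A (ψ i), y⟫_ℂ + R.mulVec α i = 0)
    (hf : f = resolvent A y + ∑ p, α p • extResolvent A (ψ p)) (g : B.domain) :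
    ‖⟪y - f, (g : H)⟫_ℂ‖ ^ 2 ≤ (⟪y - f, f⟫_ℂ).re * (⟪B g, (g : H)⟫_ℂ).re := by
  have hK := isFirmlyNonexpansive_resolvent hA hpos
  set K := resolvent A with hKdef
  set h := fun j => extResolvent A (ψ j) with hhdef
  obtain ⟨b, hb⟩ := exists_dual_family (linearIndependent_extResolvent A hψ)
  set a := ∑ p, α p • h p with ha
  let e : ℝ → H := fun m => neumann K m a
  let w : ℝ → H := fun m => y - (m : ℂ) • e m
  -- The correction by the biorthogonal family makes `z m` orthogonal to every `h_j`; it tends to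
  -- `0` with `M(m) + R`.
  let δ : ℝ → H := fun m => ∑ i, ⟪h i, w m⟫_ℂ • b i
  let z : ℝ → H := fun m => w m - δ m
  have hz : ∀ m j, ⟪h j, z m⟫_ℂ = 0 := by
    intro m j
    simp [z, δ, hb, hhdef]
  have hδ : Tendsto δ (𝓝[<] 1) (𝓝 0) := by
    have h1 : Tendsto δ (𝓝[<] 1) (𝓝 (∑ i : Fin n, (-∑ p : Fin n, 0 * α p) • b i)) := by
      refine tendsto_finsetSum _ fun i _ => Tendsto.smul_const ?_ _
      refine Tendsto.congr (fun m => (inner_sub_neumann K h m hy i).symm) ?_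
      exact (tendsto_finsetSum _ fun p _ =>
        (tendsto_weylForm_add hA hpos hψ hψ1 hS i p).mul_const _).neg
    simpa using h1
  have he : Tendsto (fun m : ℝ => ((1 - m : ℝ) : ℂ) • e m) (𝓝[<] 1) (𝓝 0) := by
    have h1 : Tendsto (fun m : ℝ => ∑ p, α p • ((1 - m : ℝ) : ℂ) • neumann K m (h p)) (𝓝[<] 1)
        (𝓝 (∑ p : Fin n, α p • (0 : H))) :=
      tendsto_finsetSum _ fun p _ => (tendsto_smul_neumann hA hpos hψ hψ1 hS p).const_smul _
    simp only [smul_zero, Finset.sum_const_zero] at h1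
    refine h1.congr fun m => ?_
    simp only [e, ha, map_sum, map_smul, Finset.smul_sum]
    exact Finset.sum_congr rfl fun p _ => smul_comm _ _ _
  have hwK : ∀ m < 1, w m - K (w m) = y - f + ((1 - m : ℝ) : ℂ) • e m := by
    intro m hm
    have h1 : e m - (m : ℂ) • K (e m) = a := hK.neumann_sub hm a
    simp only [w, map_sub, map_smul]
    rw [hf, ← h1]
    push_cast
    module
  have hwt : Tendsto (fun m => w m - K (w m)) (𝓝[<] 1) (𝓝 (y - f)) := by
    have h1 := he.const_add (y - f)
    rw [add_zero] at h1
    refine h1.congr' ?_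
    filter_upwards [self_mem_nhdsWithin] with m hm using (hwK m hm).symm
  have hKδ : Tendsto (fun m => K (δ m)) (𝓝[<] 1) (𝓝 0) := by
    have h1 := (K.continuous.tendsto 0).comp hδ
    rwa [map_zero] at h1
  have hzt : Tendsto (fun m => z m - K (z m)) (𝓝[<] 1) (𝓝 (y - f)) := by
    have h1 := hwt.sub (hδ.sub hKδ)
    rw [sub_zero, sub_zero] at h1
    refine h1.congr fun m => ?_
    simp only [z, map_sub]
    abel
  have hzB : ∀ m, ‖⟪z m - K (z m), (g : H)⟫_ℂ‖ ^ 2 ≤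
      (⟪z m - K (z m), K (z m)⟫_ℂ).re * (⟪B g, (g : H)⟫_ℂ).re := by
    intro m
    have hm := (mem_symOp_domain (ψ := ψ) hA hpos).2 ⟨z m, hz m, rfl⟩
    have h1 := sq_norm_inner_le_of_symmetric B.domain.subtype B.toFun
      (fun x y => inner_apply_eq_of_isSelfAdjoint hBs x y) hBn ⟨K (z m), hB.1 hm⟩ g
    have h2 : B ⟨K (z m), hB.1 hm⟩ = z m - K (z m) := by
      rw [← symOp_apply hA hpos (z m) hm]
      exact (hB.2 rfl).symm
    change ‖⟪B ⟨K (z m), hB.1 hm⟩, (g : H)⟫_ℂ‖ ^ 2 ≤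
      (⟪B ⟨K (z m), hB.1 hm⟩, K (z m)⟫_ℂ).re * _ at h1
    rwa [h2] at h1
  -- The form identity is used with its two nonnegative terms `(1 - m) ‖K w‖²` and `(w, a)` dropped;
  -- the rest is the effect of `δ`.
  have hbound : ∀ m < 1, (⟪z m - K (z m), K (z m)⟫_ℂ).re ≤
      (⟪y - f, f⟫_ℂ).re + (1 - m) * ‖f‖ ^ 2 - 2 * (⟪w m - K (w m), K (δ m)⟫_ℂ).re +
        (⟪δ m - K (δ m), K (δ m)⟫_ℂ).re := by
    intro m hm
    have h1 := hK.re_inner_sub_eq hm hf (z := w m) rfl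
    have h2 : 0 ≤ (⟪w m, a⟫_ℂ).re := re_inner_sub_neumann_nonneg hA hpos hψ hψ1 hS hy hm
    have h3 : 0 ≤ (1 - m) * ‖K (w m)‖ ^ 2 := mul_nonneg (by linarith) (sq_nonneg _)
    have h4 : (⟪δ m - K (δ m), K (w m)⟫_ℂ).re = (⟪w m - K (w m), K (δ m)⟫_ℂ).re := by
      rw [re_inner_comm, inner_sub_left, inner_sub_right, hK.symm (w m) (δ m)]
    have h5 : (⟪z m - K (z m), K (z m)⟫_ℂ).re = (⟪w m - K (w m), K (w m)⟫_ℂ).re -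
        (⟪w m - K (w m), K (δ m)⟫_ℂ).re - (⟪δ m - K (δ m), K (w m)⟫_ℂ).re +
        (⟪δ m - K (δ m), K (δ m)⟫_ℂ).re := by
      have h6 : z m - K (z m) = (w m - K (w m)) - (δ m - K (δ m)) := by
        simp only [z, map_sub]; abel
      rw [h6, show K (z m) = K (w m) - K (δ m) from map_sub _ _ _, inner_sub_left, inner_sub_right,
        inner_sub_right]
      simp only [Complex.sub_re]
      ring
    rw [h5, h4]
    linarith
  have hlim : Tendsto (fun m : ℝ => (⟪y - f, f⟫_ℂ).re + (1 - m) * ‖f‖ ^ 2 -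
      2 * (⟪w m - K (w m), K (δ m)⟫_ℂ).re + (⟪δ m - K (δ m), K (δ m)⟫_ℂ).re) (𝓝[<] 1)
      (𝓝 ((⟪y - f, f⟫_ℂ).re + (1 - 1) * ‖f‖ ^ 2 - 2 * (⟪y - f, (0 : H)⟫_ℂ).re +
        (⟪(0 : H) - 0, (0 : H)⟫_ℂ).re)) := by
    refine Tendsto.add (Tendsto.sub ?_ ?_) ?_
    · exact (Continuous.tendsto (by fun_prop) 1).mono_left nhdsWithin_le_nhds
    · exact ((Complex.continuous_re.tendsto _).comp (hwt.inner hKδ)).const_mul 2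
    · exact (Complex.continuous_re.tendsto _).comp ((hδ.sub hKδ).inner hKδ)
  simp only [sub_self, zero_mul, add_zero, inner_zero_right, Complex.zero_re, mul_zero,
    sub_zero] at hlim
  have hleft : Tendsto (fun m => ‖⟪z m - K (z m), (g : H)⟫_ℂ‖ ^ 2) (𝓝[<] 1)
      (𝓝 (‖⟪y - f, (g : H)⟫_ℂ‖ ^ 2)) := ((hzt.inner tendsto_const_nhds).norm).pow 2
  refine le_of_tendsto_of_tendsto hleft (hlim.mul_const _) ?_
  filter_upwards [self_mem_nhdsWithin] with m hm
  exact (hzB m).trans (mul_le_mul_of_nonneg_right (hbound m hm) (hBn g))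

lemma resolvent_le_resolvent_extensionOf (hA : IsSelfAdjoint A) (hpos : IsNonneg A)
    (hd : Dense ((symOp A ψ).domain : Set H)) (hR : R.IsHermitian)
    (hψ : LinearIndependent ℂ ψ) (hψ1 : ∀ i, ¬ MemHNegOne A (ψ i))
    (hS : HasScalings (resolvent A) (fun j => extResolvent A (ψ j)) R)
    {B : H →ₗ.[ℂ] H} (hB : symOp A ψ ≤ B) (hBs : IsSelfAdjoint B) (hBn : IsNonneg B) :
    resolvent B ≤ resolvent (extensionOf A ψ R) := by
  have hNs := isSelfAdjoint_extensionOf hA hpos hd hψ hR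
  have hNn := isNonneg_extensionOf hA hpos hd hψ hψ1 hS
  have hKN := isFirmlyNonexpansive_resolvent hNs hNn
  have hKB := isFirmlyNonexpansive_resolvent hBs hBn
  rw [ContinuousLinearMap.le_def]
  refine ⟨fun x y => ?_, fun x => ?_⟩
  · change ⟪resolvent (extensionOf A ψ R) x - resolvent B x, y⟫_ℂ =
      ⟪x, resolvent (extensionOf A ψ R) y - resolvent B y⟫_ℂ
    rw [inner_sub_left, inner_sub_right, hKN.symm, hKB.symm]
  change 0 ≤ (⟪resolvent (extensionOf A ψ R) x - resolvent B x, x⟫_ℂ).re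
  set f := resolvent (extensionOf A ψ R) x
  set g := resolvent B x
  have hfm : f ∈ (extensionOf A ψ R).domain := resolvent_mem hNs hNn x
  have hgm : g ∈ B.domain := resolvent_mem hBs hBn x
  obtain ⟨y, α, hy, hf⟩ := (mem_extensionOf hA hpos).1 hfm
  have hyx : y = x := by
    have h1 := apply_resolvent hNs hNn x hfm
    rw [extensionOf_apply hA hpos hd ⟨_, hfm⟩ hf] at h1
    exact sub_left_injective h1
  subst hyx
  have h1 := sq_norm_inner_extensionOf_le hA hpos hψ hψ1 hS hB hBs hBn hy hf ⟨g, hgm⟩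
  rw [apply_resolvent hBs hBn y hgm] at h1
  change ‖⟪y - f, g⟫_ℂ‖ ^ 2 ≤ (⟪y - f, f⟫_ℂ).re * (⟪y - g, g⟫_ℂ).re at h1
  have hF : (⟪y - f, f⟫_ℂ).re = (⟪f, y⟫_ℂ).re - ‖f‖ ^ 2 := by
    rw [inner_sub_left, Complex.sub_re, re_inner_self, re_inner_comm]
  have hG : (⟪y - g, g⟫_ℂ).re = (⟪g, y⟫_ℂ).re - ‖g‖ ^ 2 := by
    rw [inner_sub_left, Complex.sub_re, re_inner_self, re_inner_comm]
  have h2 : (⟪g, y⟫_ℂ).re ≤ ‖⟪y - f, g⟫_ℂ‖ + ‖f‖ * ‖g‖ := by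
    have h3 : (⟪g, y⟫_ℂ).re = (⟪y - f, g⟫_ℂ).re + (⟪f, g⟫_ℂ).re := by
      rw [← Complex.add_re, ← inner_add_left, sub_add_cancel, re_inner_comm]
    rw [h3]
    exact add_le_add (Complex.re_le_norm _)
      ((Complex.re_le_norm _).trans (norm_inner_le_norm _ _))
  have hFn : 0 ≤ (⟪y - f, f⟫_ℂ).re := hKN.re_inner_sub_nonneg y
  have hGn : 0 ≤ (⟪y - g, g⟫_ℂ).re := hKB.re_inner_sub_nonneg y
  rw [inner_sub_left, Complex.sub_re, sub_nonneg]
  by_contra! hlt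
  rw [hF] at h1 hFn
  rw [hG] at h1 hGn
  set F := (⟪f, y⟫_ℂ).re
  set G := (⟪g, y⟫_ℂ).re
  set N := ‖⟪y - f, g⟫_ℂ‖
  have hN0 : 0 ≤ N := norm_nonneg _
  have hf0 := norm_nonneg f
  have hg0 := norm_nonneg g
  have h4 : N ≤ Real.sqrt (F - ‖f‖ ^ 2) * Real.sqrt (G - ‖g‖ ^ 2) := by
    rw [← Real.sqrt_mul hFn]
    exact Real.le_sqrt_of_sq_le h1
  have e1 := Real.sq_sqrt hFn
  have e2 := Real.sq_sqrt hGn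
  -- By the arithmetic–geometric mean inequality `N + ‖f‖ ‖g‖ ≤ (F + G) / 2`, so `G ≤ (F + G) / 2`.
  nlinarith [sq_nonneg (Real.sqrt (F - ‖f‖ ^ 2) - Real.sqrt (G - ‖g‖ ^ 2)),
    sq_nonneg (‖f‖ - ‖g‖)]

end SingularPerturbation

/-! ### The main theorem -/

theorem mainTheorem5 {H : Type*} [NormedAddCommGroup H] [InnerProductSpace ℂ H] [CompleteSpace H]
    (A₀ : H →ₗ.[ℂ] H) (hA₀ : IsSelfAdjoint A₀) (hA₀_nonneg : IsNonneg A₀)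
    {T : Set ℝ} (U : T → H ≃ₗᵢ[ℂ] H) (hU : ∀ t : T, ∃ s : T, U s = (U t).symm)
    (p : T → ℝ) (hp : IsHomogeneous U p A₀)
    {n : ℕ} (ψ : Fin n → HNegTwo A₀) (hψ : LinearIndependent ℂ ψ)
    (ξ : Fin n → T → ℝ)
    (hξ : ∀ (j : Fin n) (t : T), extUnitary A₀ (U t) (ψ j) = (ξ j t : ℂ) • ψ j)
    (hψ_indep : ∀ φ ∈ Submodule.span ℂ (Set.range ψ), MemHNegOne A₀ φ → φ = 0)
    (hR : ∃! R : Matrix (Fin n) (Fin n) ℂ, ∀ (t : T) (i j : Fin n),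
      ((ξ i t - p t / ξ j t : ℝ) : ℂ) * R i j =
        (1 - (p t : ℂ)) * inner ℂ (U t (extResolvent A₀ (ψ i))) (extResolvent A₀ (ψ j))) :
    ∃ A : H →ₗ.[ℂ] H,
      (IsAdmissibleOperator A₀ ψ A ∧ IsHomogeneous U p A) ∧
      (∀ B : H →ₗ.[ℂ] H, IsAdmissibleOperator A₀ ψ B ∧ IsHomogeneous U p B → B = A) ∧
      IsKreinVonNeumannExtension (symOp A₀ ψ) A := by
  have hd := dense_symOp_domain hA₀ hA₀_nonneg hψ_indep
  have hψ1 : ∀ i, ¬ MemHNegOne A₀ (ψ i) := fun i hi =>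
    hψ.ne_zero i (hψ_indep _ (Submodule.subset_span ⟨i, rfl⟩) hi)
  have hsc : ∀ s t : T, U s = (U t).symm → _ := fun s t hst =>
    hp.isScaling hA₀ hA₀_nonneg hψ hξ hst
  have hsymm : ∀ s t : T, U s = (U t).symm → U t = (U s).symm := fun s t hst => by
    rw [hst, LinearIsometryEquiv.symm_symm]
  -- the scaling equations for `U t` are equivalent to the given ones for the inverse of `U t`
  have hequiv : ∀ s t : T, U s = (U t).symm → ∀ (i j : Fin n) (r : ℂ),
      ((ξ i s - p s / ξ j s : ℝ) : ℂ) * r =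
        (1 - (p s : ℂ)) * ⟪U s (extResolvent A₀ (ψ i)), extResolvent A₀ (ψ j)⟫_ℂ ↔
      (ξ j t - (p t : ℂ) / ξ i t) * r =
        (1 - (p t : ℂ)) * ⟪extResolvent A₀ (ψ i), U t (extResolvent A₀ (ψ j))⟫_ℂ := by
    intro s t hst i j r
    obtain ⟨h1, h2⟩ := hsc s t hst
    have hpt : (p t : ℂ) ≠ 0 := by exact_mod_cast hp.scale_ne_zero t
    have hi : (ξ i t : ℂ) ≠ 0 := by exact_mod_cast h2.ne_zero i
    have hj : (ξ j t : ℂ) ≠ 0 := by exact_mod_cast h2.ne_zero j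
    rw [IsScaling.inner_map, hst, eq_inv_of_mul_eq_one_left (h1 i),
      eq_inv_of_mul_eq_one_left (h1 j), eq_inv_of_mul_eq_one_left (hp.scale_mul_scale hst)]
    push_cast
    rw [← mul_right_inj' (neg_ne_zero.2 hpt)]
    refine iff_of_eq (congrArg₂ _ ?_ ?_) <;> field_simp <;> ring
  obtain ⟨R, hReq, hRuniq⟩ := hR
  have hReq' : ∀ (t : T) (i j : Fin n), (ξ j t - (p t : ℂ) / ξ i t) * R i j =
      (1 - (p t : ℂ)) * ⟪extResolvent A₀ (ψ i), U t (extResolvent A₀ (ψ j))⟫_ℂ := by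
    intro t i j
    obtain ⟨s, hst⟩ := hU t
    exact (hequiv s t hst i j _).1 (hReq s i j)
  -- Conjugating the equations for the inverse unitaries shows that the conjugate transpose of `R`
  -- is also a solution.
  have hRH : R.IsHermitian := by
    refine hRuniq _ fun t i j => ?_
    have h1 := congrArg conj (hReq' t j i)
    simp only [map_mul, map_sub, map_div₀, Complex.conj_ofReal, inner_conj_symm, map_one] at h1
    rw [Matrix.conjTranspose_apply]
    push_cast
    exact h1
  have hne : ∀ i j, ∃ t : T, ξ i t * ξ j t ≠ p t := by
    intro i j
    by_contra! hc
    -- If the coefficient of `r_ij` vanished for every `t`, this entry could be changed freely.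
    have h1 := hRuniq (R + Matrix.single i j 1) fun t k l => by
      rw [Matrix.add_apply, mul_add, hReq, add_eq_left, Matrix.single_apply]
      split_ifs with hkl
      · obtain ⟨rfl, rfl⟩ := hkl
        obtain ⟨s, hst⟩ := hU t
        rw [← hc t, mul_div_cancel_right₀ _ ((hsc s t hst).2.ne_zero j)]
        simp
      · rw [mul_zero]
    have h2 := congrFun (congrFun h1 i) j
    simp at h2
  have hS : HasScalings (resolvent A₀) (fun j => extResolvent A₀ (ψ j)) R := by
    intro i j
    obtain ⟨t, ht⟩ := hne i j
    obtain ⟨s, hst⟩ := hU t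
    obtain ⟨h1, h2⟩ := hsc s t hst
    have hps := hp.scale_mul_scale hst
    -- Passing to the inverse unitary if necessary arranges `q ≥ 1` and keeps the pair
    -- nondegenerate.
    rcases le_total 1 (p t) with hle | hle
    · exact ⟨U t, p t, fun j => ξ j t, h2, hle, ht, hReq' t⟩
    · refine ⟨U s, p s, fun j => ξ j s, (hsc t s (hsymm s t hst)).2, ?_, fun h => ht ?_, hReq' s⟩
      · rw [eq_inv_of_mul_eq_one_left hps]
        exact (one_le_inv₀ h2.pos).2 hle
      · have h3 : (ξ i s * ξ j s) * (ξ i t * ξ j t) = 1 := by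
          rw [mul_mul_mul_comm, h1, h1, one_mul]
        rw [h] at h3
        exact mul_left_cancel₀ (left_ne_zero_of_mul_eq_one hps) (h3.trans hps.symm)
  have hmap : ∀ (t : T) (f : (extensionOf A₀ ψ R).domain), _ := fun t f =>
    mem_and_map_extensionOf hA₀ hA₀_nonneg hd (hsc _ t (hU t).choose_spec).2 (hReq' t) f
  refine ⟨extensionOf A₀ ψ R, ⟨⟨R, ⟨hRH, fun c hc => ?_⟩, rfl⟩, ?_⟩, ?_, ?_⟩
  -- Admissibility is tested only on `ψ = 0`, hence on `c = 0`, where both sides vanish.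
  · have h0 : ∑ j, c j • ψ j = 0 := hψ_indep _ (Submodule.sum_mem _ fun j _ =>
      Submodule.smul_mem _ _ (Submodule.subset_span ⟨j, rfl⟩)) hc
    have hc0 : ∀ j, c j = 0 := Fintype.linearIndependent_iff.1 hψ c h0
    intro w f h _ _ hh
    have hh0 : h = 0 := Subtype.ext (by
      rw [hh, h0]; exact map_zero (extResolventₗᵢ A₀))
    rw [hh0, LinearPMap.map_zero, inner_zero_left]
    simp [hc0]
  · have hmem : ∀ (t : T) (x : H), x ∈ (extensionOf A₀ ψ R).domain ↔
        U t x ∈ (extensionOf A₀ ψ R).domain := by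
      intro t x
      refine ⟨fun hx => (hmap t ⟨x, hx⟩).1, fun hx => ?_⟩
      obtain ⟨s, hst⟩ := hU t
      have := (hmap s ⟨_, hx⟩).1
      rwa [hst, LinearIsometryEquiv.symm_apply_apply] at this
    exact ⟨exists_extensionOf_ne_zero hA₀ hA₀_nonneg hd hp.ne_zero, hmem,
      fun t x => (hmap t x).2⟩
  · rintro B ⟨⟨R', -, rfl⟩, hB⟩
    congr 1
    refine hRuniq R' fun s i j => ?_
    obtain ⟨t, hst⟩ := hU s
    refine (hequiv s t (hsymm t s hst) i j _).2 ?_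
    exact scaling_eq_of_map_extensionOf hA₀ hA₀_nonneg hd hψ (hsc s t (hsymm t s hst)).2
      (fun f => ⟨(hB.mem_iff t f).1 f.2, hB.map_eq t f⟩) i j
  · exact ⟨symOp_le_extensionOf hA₀ hA₀_nonneg hd,
      isSelfAdjoint_extensionOf hA₀ hA₀_nonneg hd hψ hRH,
      isNonneg_extensionOf hA₀ hA₀_nonneg hd hψ hψ1 hS,
      fun B hB hBs hBn => resolvent_le_resolvent_extensionOf hA₀ hA₀_nonneg hd hRH hψ hψ1 hS
        hB hBs hBn⟩
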